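/- Notation. Functions on $\mathbb{R}$ are identified when they agree almost everywhere. $\int_{\mathbb R}|u'|$ denotes the (distributional) total variation of $u$, and $BV(\mathbb{R})$ is the set of $u\in L^1(\mathbb{R})$ with $\int_{\mathbb R}|u'|<\infty$. For $f$ on $\mathbb{R}$ put $\|f\|_*:=\sup\{|\int_{\mathbb R} f v| : v\in L^1(\mathbb{R}),\ \int_{\mathbb R}|v'|\le 1\}$. Bar codes. $\mathcal{B}$ is the set of $u\in BV(\mathbb{R})$ with values in $\{0,1\}$ a.e. and $u=0$ a.e. outside $[0,1]$. Such a $u$ divides $[0,1]$ into finitely many intervals on which $u=1$ (bars) and $u=0$ (spaces) alternately; $\mathcal{B}_\omega$ is the set of $u\in\mathcal{B}$ all of whose bars and spaces in $[0,1]$ have width at least $\omega$. For $i,j\in\{0,1\}$, $\mathcal{B}^{ij}$ is the set of $u\in\mathcal{B}$ such that $u=i$ on $[0,x_1]$ and $u=j$ on $[x_2,1]$ for some $0<x_1\le 1$, $0\le x_2<1$, and $\mathcal{B}^{ij}_\omega:=\mathcal{B}_\omega\cap\mathcal{B}^{ij}$. Kernels. For $\sigma>0$, a kernel of size $\sigma$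 in the class $\mathcal{K}$ is a function $\phi_\sigma\in L^1(\mathbb{R})$ of the form $\phi_\sigma(x)=p(-x)\chi_{[-\sigma,0]}(x)+p(x)\chi_{[0,\sigma]}(x)$ with $p:[0,\sigma]\to[0,\infty)$ non-increasing and $\int_0^\sigma p=\frac12$. The hat kernel is $\hat\phi_\sigma(x)=\frac1\sigma\bigl(1-\frac{|x|}\sigma\bigr)$ for $|x|<\sigma$ and $\hat\phi_\sigma(x)=0$ otherwise. Functional. For $\lambda,\sigma,\rho>0$, kernels $\phi_\sigma,\phi_\rho$ of sizes $\sigma,\rho$, and a bar code $z$, let $f_\sigma:=\phi_\sigma*z$ and $$F_3(u):=\int_{\mathbb R}|u'|+\lambda\,\|\phi_\rho*u-f_\sigma\|_{L^2(\mathbb R)}^2,$$ with $F_3(u)=\infty$ if $\phi_\rho*u-f_\sigma\notin L^2(\mathbb{R})$. Theorem. Let $\lambda>0$. 1. Let $\sigma,\rho>0$, let $\phi_\sigma,\phi_\rho\in\mathcal{K}$ be kernels of sizes $\sigma$ and $\rho$, and let $z\in\mathcal{B}$. Then $u\equiv 0$ is the unique minimiser of $F_3$ over $BV(\mathbb{R})$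 if and only if $\|\phi_\rho*f_\sigma\|_*\le\frac1{2\lambda}$. 2. Let $\phi_\sigma=\hat\phi_\sigma$ and $\phi_\rho=\hat\phi_\rho$, let $z\in\mathcal{B}^{ij}_\omega$ for some $i,j\in\{0,1\}$, and let $0<\sigma\le\rho\le\frac\omega2$. If $$\frac2\lambda+\frac1{15\rho^2}\bigl(-\sigma^3+5\rho\sigma^2+17\rho^3\bigr)<\omega,$$ then $u=z$ is the unique minimiser of $F_3$ over $\mathcal{B}^{ij}$. -/

import Mathlib

open MeasureTheory Set
open scoped ENNReal Convolution

namespace BarCode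

/-- The total variation `∫ |u'|` of a (locally integrable) function on the line, in the sense of
distributions: the supremum of `∫ u g'` over `g` of class `C¹` with compact support, `|g| ≤ 1`. -/
noncomputable def totalVariation (u : ℝ → ℝ) : ℝ≥0∞ :=
  ⨆ g ∈ {g : ℝ → ℝ | ContDiff ℝ 1 g ∧ HasCompactSupport g ∧ ∀ x, |g x| ≤ 1},
    ENNReal.ofReal (∫ x, u x * deriv g x)

/-- The space `BV(ℝ)`: integrable functions of finite total variation. Functions stand for their
classes modulo null sets; every notion below depends on the class only. -/
def BV : Set (ℝ → ℝ) :=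
  {u | Integrable u volume ∧ totalVariation u < ∞}

/-- Convolution on the line, `(φ * u)(x) = ∫ φ(y) u(x - y) dy`. -/
noncomputable def conv (φ u : ℝ → ℝ) : ℝ → ℝ :=
  φ ⋆[ContinuousLinearMap.mul ℝ ℝ, volume] u

/-- The dual norm `‖f‖_* = sup { |∫ f v| : v ∈ L¹(ℝ), ∫ |v'| ≤ 1 }`. -/
noncomputable def starNorm (f : ℝ → ℝ) : ℝ≥0∞ :=
  ⨆ v ∈ {v : ℝ → ℝ | Integrable v volume ∧ totalVariation v ≤ 1},
    ENNReal.ofReal |∫ x, f x * v x|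

/-- The kernels of size `σ` in the class `𝒦`: nonnegative, symmetric, unimodal, supported in
`[-σ, σ]` and of unit mass. -/
def kernelClass (σ : ℝ) : Set (ℝ → ℝ) :=
  {φ | 0 < σ ∧ Integrable φ volume ∧
    ∃ p : ℝ → ℝ, (∀ x ∈ Icc 0 σ, 0 ≤ p x) ∧ AntitoneOn p (Icc 0 σ) ∧
      (∫ x in (0 : ℝ)..σ, p x) = 1 / 2 ∧
      φ =ᵐ[volume] fun x =>
        (Icc (-σ) 0).indicator (fun y => p (-y)) x + (Icc 0 σ).indicator p x}

/-- The hat kernel of size `σ`. -/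
noncomputable def hatKernel (σ : ℝ) (x : ℝ) : ℝ :=
  if |x| < σ then (1 - |x| / σ) / σ else 0

/-- The general admissible set `𝓑` of bar codes. -/
def barCodes : Set (ℝ → ℝ) :=
  {u | u ∈ BV ∧ (∀ᵐ x, u x = 0 ∨ u x = 1) ∧ ∀ᵐ x, x ∉ Icc (0 : ℝ) 1 → u x = 0}

/-- `[0, 1]` is divided by `0 = t₀ < t₁ < ⋯ < tₙ = 1` into the bars and the spaces of `u`: almost
everywhere `u` is `c` on the intervals number `0, 2, 4, …` and `1 - c` on those number
`1, 3, 5, …`, with `c ∈ {0, 1}`. -/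
def IsDivision (u : ℝ → ℝ) (n : ℕ) (t : ℕ → ℝ) (c : ℝ) : Prop :=
  (c = 0 ∨ c = 1) ∧ t 0 = 0 ∧ t n = 1 ∧
    ∀ k < n, t k < t (k + 1) ∧
      ∀ᵐ x, x ∈ Ioo (t k) (t (k + 1)) → u x = if Even k then c else 1 - c

/-- The set `𝓑_ω` of bar codes all of whose bars and spaces have width at least `ω`. -/
def generatingBarCodes (ω : ℝ) : Set (ℝ → ℝ) :=
  {u | u ∈ barCodes ∧
    ∃ (n : ℕ) (t : ℕ → ℝ) (c : ℝ), IsDivision u n t c ∧ ∀ k < n, ω ≤ t (k + 1) - t k}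

/-- The set `𝓑^{ij}` of bar codes that start with the value `i` and end with the value `j`. -/
def barCodesEnds (i j : Fin 2) : Set (ℝ → ℝ) :=
  {u | u ∈ barCodes ∧
    (∃ x₁ : ℝ, 0 < x₁ ∧ x₁ ≤ 1 ∧ ∀ᵐ x, x ∈ Icc 0 x₁ → u x = ((i : ℕ) : ℝ)) ∧
    (∃ x₂ : ℝ, 0 ≤ x₂ ∧ x₂ < 1 ∧ ∀ᵐ x, x ∈ Icc x₂ 1 → u x = ((j : ℕ) : ℝ))}

/-- The functional `u ↦ ∫ |u'| + λ ‖φ * u - f‖²` with the `L²(ℝ)` norm; the value is `∞` if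
`φ * u - f` is not in `L²(ℝ)`. -/
noncomputable def deblurFunctional (lam : ℝ) (φ f : ℝ → ℝ) (u : ℝ → ℝ) : ℝ≥0∞ :=
  totalVariation u +
    ENNReal.ofReal lam * eLpNorm (fun x => conv φ u x - f x) 2 volume ^ 2

/-- `u` is, up to equality almost everywhere, the unique minimiser of `F` over `S`. -/
def IsUniqueMinimiser (F : (ℝ → ℝ) → ℝ≥0∞) (S : Set (ℝ → ℝ)) (u : ℝ → ℝ) : Prop :=
  u ∈ S ∧ IsMinOn F S u ∧ ∀ v ∈ S, IsMinOn F S v → v =ᵐ[volume] u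

end BarCode

/-!
Write `F` for the functional, `φ` for its kernel, `f` for the data and `TV` for the total variation.

*The zero minimiser.* As `φ` is even, convolution with it is self-adjoint, and
`F u = TV u + λ (‖φ * u‖² - 2 ∫ (φ * f) u + ‖f‖²)`. If the dual norm of `φ * f` is at most
`1 / (2λ)`, the linear term is dominated by `TV u` and `F u ≥ F 0`; in case of equality `φ * u = 0`,
so the linear term vanishes and with it `TV u`, and an integrable function without variation is
zero. Conversely, comparing `0` with `s v` for small `s` of either sign gives the bound on the dual
norm. This is `isUniqueMinimiser_zero_iff`. It uses that functions in `BV` are bounded, which comes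
from `exists_eVariationOn_le`: off a null set the pointwise variation is at most `TV`.

*The generating bar code.* Let `z` have its `N` jumps at `τ 1 < ⋯ < τ N`, at least `ω ≥ 2ρ` apart.
A bar code `u` differs from `z` by `w = ∑ (-1) ^ k 1_{A k}` with `A k` inside the `k`-th interval
between jumps; let `M` be the set of those `k` for which `A k` is the full interval. Then `u` agrees
with `z` somewhere in every other interval, so `TV z ≤ N ≤ TV u + 2 |M|`
(`Fits.le_totalVariation_add`). It remains to see that the data term pays more than `2 |M|`. Its
increase is `λ` times `‖φ_ρ * w‖² + 2 ∫ (φ_ρ * w) (φ_ρ * z - φ_σ * z)`. Since the kernel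
`φ_ρ * φ_ρ` lives on `[-2ρ, 2ρ]`, only sets in equal or adjacent intervals interact, and each jump
interacts only with the two sets next to it.

* The linear terms are nonnegative (`stepInteraction_le_of_subset_Iic` and
  `stepInteraction_le_of_subset_Ici`): `φ_ρ * φ_ρ` is more spread out than `φ_ρ * φ_σ`.
* A full interval contributes at least `ω - E|X + X'|` (`le_interaction_self`), where `X`, `X'` are
  independent with density `φ_ρ`.
* The negative interaction across a jump, combined with the linear term there, is at least
  `-E|X + Y|` (`interaction_le_of_separated`), where `Y` is independent with density `φ_σ`.
* The energy of the part of `w` on the remaining intervals is nonnegative and is dropped, together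
  with the interactions inside it.

Hence the increase is at least `λ |M| (ω - E|X + X'| - 2 E|X + Y|)`, see
`Fits.energy_lower_bound`. The two means are computed from explicit piecewise polynomials
(`integral_hatCdf₂`), and the hypothesis says precisely that this beats `2 |M|`. In case of equality
`M` is empty and `φ_ρ * w = 0`, which forces `w = 0` by the alternating signs
(`Fits.volume_eq_zero_of_conv`).
-/

namespace BarCode

open Filter Topology

/-! ### Convolution with bounded functions -/

lemma conv_apply (φ g : ℝ → ℝ) (x : ℝ) : conv φ g x = ∫ t, φ t * g (x - t) := rfl

lemma conv_apply_swap (φ g : ℝ → ℝ) (x : ℝ) : conv φ g x = ∫ t, φ (x - t) * g t := by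
  rw [conv, convolution_eq_swap]
  rfl

lemma conv_congr_right (φ : ℝ → ℝ) {g h : ℝ → ℝ} (e : g =ᵐ[volume] h) : conv φ g = conv φ h :=
  convolution_congr _ EventuallyEq.rfl e

lemma memLp_top_bound {g : ℝ → ℝ} (hg : MemLp g ∞ volume) : ∃ C, ∀ᵐ x, |g x| ≤ C := by
  refine ⟨(eLpNorm g ∞ volume).toReal, ?_⟩
  have h : ∀ᵐ x, ‖g x‖ₑ ≤ eLpNorm g ∞ volume := by
    simpa [eLpNorm_exponent_top] using (ae_le_eLpNormEssSup (f := g) (μ := volume))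
  filter_upwards [h] with x hx
  have := ENNReal.toReal_mono hg.eLpNorm_ne_top hx
  simpa using this

lemma integrable_conv_integrand {φ g : ℝ → ℝ} (hφ : Integrable φ volume) (hg : MemLp g ∞ volume)
    (x : ℝ) : Integrable (fun t => φ t * g (x - t)) volume := by
  have h := hg.comp_measurePreserving (Measure.measurePreserving_sub_left volume x)
  exact hφ.mul_of_top_left h

lemma conv_add {φ g h : ℝ → ℝ} (hφ : Integrable φ volume) (hg : MemLp g ∞ volume)
    (hh : MemLp h ∞ volume) (x : ℝ) : conv φ (fun y => g y + h y) x = conv φ g x + conv φ h x := by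
  simp only [conv_apply, mul_add]
  exact integral_add (integrable_conv_integrand hφ hg x) (integrable_conv_integrand hφ hh x)

lemma conv_sub {φ g h : ℝ → ℝ} (hφ : Integrable φ volume) (hg : MemLp g ∞ volume)
    (hh : MemLp h ∞ volume) (x : ℝ) : conv φ (fun y => g y - h y) x = conv φ g x - conv φ h x := by
  simp only [conv_apply, mul_sub]
  exact integral_sub (integrable_conv_integrand hφ hg x) (integrable_conv_integrand hφ hh x)

lemma conv_const_mul (φ g : ℝ → ℝ) (c x : ℝ) : conv φ (fun y => c * g y) x = c * conv φ g x := by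
  simp only [conv_apply, ← integral_const_mul]
  congr 1; ext t; ring

lemma conv_sum {ι : Type*} {φ : ℝ → ℝ} (hφ : Integrable φ volume) (s : Finset ι) (g : ι → ℝ → ℝ)
    (hg : ∀ k ∈ s, MemLp (g k) ∞ volume) (x : ℝ) :
    conv φ (fun y => ∑ k ∈ s, g k y) x = ∑ k ∈ s, conv φ (g k) x := by
  simp only [conv_apply, Finset.mul_sum]
  exact integral_finsetSum _ fun k hk => integrable_conv_integrand hφ (hg k hk) x

lemma conv_mono {φ g h : ℝ → ℝ} (hφ : Integrable φ volume) (h0 : ∀ x, 0 ≤ φ x)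
    (hg : MemLp g ∞ volume) (hh : MemLp h ∞ volume) (hgh : ∀ x, g x ≤ h x) (x : ℝ) :
    conv φ g x ≤ conv φ h x :=
  integral_mono (integrable_conv_integrand hφ hg x) (integrable_conv_integrand hφ hh x)
    fun t => mul_le_mul_of_nonneg_left (hgh _) (h0 t)

lemma conv_nonneg {φ g : ℝ → ℝ} (h0 : ∀ x, 0 ≤ φ x) (hg : ∀ x, 0 ≤ g x) (x : ℝ) :
    0 ≤ conv φ g x :=
  integral_nonneg fun t => mul_nonneg (h0 t) (hg _)

lemma integrable_conv {φ g : ℝ → ℝ} (hφ : Integrable φ volume) (hg : Integrable g volume) :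
    Integrable (conv φ g) volume :=
  hφ.integrable_convolution (ContinuousLinearMap.mul ℝ ℝ) hg

lemma abs_conv_le {φ g : ℝ → ℝ} (hφ : Integrable φ volume) {C : ℝ} (hC : ∀ᵐ x, |g x| ≤ C) (x : ℝ) :
    |conv φ g x| ≤ (∫ t, |φ t|) * C := by
  rw [conv_apply, ← integral_mul_const]
  rw [← Real.norm_eq_abs]
  refine norm_integral_le_of_norm_le (hφ.abs.mul_const C) ?_
  have := (Measure.measurePreserving_sub_left volume x).quasiMeasurePreserving.ae hC
  filter_upwards [this] with t ht
  rw [Real.norm_eq_abs, abs_mul]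
  exact mul_le_mul_of_nonneg_left ht (abs_nonneg _)

lemma memLp_top_conv {φ g : ℝ → ℝ} (hφ : Integrable φ volume) (hg : Integrable g volume)
    (hg' : MemLp g ∞ volume) : MemLp (conv φ g) ∞ volume := by
  obtain ⟨C, hC⟩ := memLp_top_bound hg'
  exact memLp_top_of_bound (integrable_conv hφ hg).aestronglyMeasurable _
    (Eventually.of_forall fun x => abs_conv_le hφ hC x)

lemma memLp_two {f : ℝ → ℝ} (hf : Integrable f volume) (hf' : MemLp f ∞ volume) :
    MemLp f 2 volume := by
  rw [memLp_two_iff_integrable_sq hf.aestronglyMeasurable]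
  simp only [sq]
  exact hf.mul_of_top_left hf'

lemma integrable_mul_top {f g : ℝ → ℝ} (hf : Integrable f volume) (hg : MemLp g ∞ volume) :
    Integrable (fun x => f x * g x) volume := hf.mul_of_top_left hg

/-- Convolution with an even kernel is self-adjoint for the pairing of `L¹` with `L^∞`. -/
lemma integral_conv_mul {φ f g : ℝ → ℝ} (hφ : Integrable φ volume) (hev : ∀ᵐ x, φ (-x) = φ x)
    (hf : Integrable f volume) (hg : MemLp g ∞ volume) :
    ∫ x, conv φ f x * g x = ∫ x, f x * conv φ g x := by
  have hI : Integrable (fun p : ℝ × ℝ => f p.2 * φ (p.1 - p.2) * g p.1) (volume.prod volume) := by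
    have h1 := hf.convolution_integrand (ContinuousLinearMap.mul ℝ ℝ) hφ
    obtain ⟨C, hC⟩ := memLp_top_bound hg
    refine h1.mul_bdd (c := C) hg.aestronglyMeasurable.comp_fst ?_
    exact Measure.quasiMeasurePreserving_fst.ae hC
  calc ∫ x, conv φ f x * g x = ∫ x, ∫ y, f y * φ (x - y) * g x := by
        congr 1; ext x
        rw [conv_apply_swap, ← integral_mul_const]
        congr 1; ext y; ring
    _ = ∫ y, ∫ x, f y * φ (x - y) * g x := integral_integral_swap hI
    _ = ∫ y, f y * conv φ g y := by
        congr 1; ext y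
        rw [conv_apply_swap, ← integral_const_mul]
        have := (Measure.measurePreserving_sub_left volume y).quasiMeasurePreserving.ae hev
        refine integral_congr_ae ?_
        filter_upwards [this] with x hx
        rw [neg_sub] at hx
        rw [hx]; ring

/-- The square of the `L²` norm as a Bochner integral. -/
lemma eLpNorm_two_sq {f : ℝ → ℝ} (hf : MemLp f 2 volume) :
    eLpNorm f 2 volume ^ 2 = ENNReal.ofReal (∫ x, f x ^ 2) := by
  rw [hf.eLpNorm_eq_integral_rpow_norm (by norm_num) (by norm_num), ← ENNReal.ofReal_pow (by positivity)]
  congr 1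
  have h0 : 0 ≤ ∫ x, f x ^ 2 := integral_nonneg fun x => sq_nonneg _
  simp only [ENNReal.toReal_ofNat, Real.rpow_ofNat, Real.norm_eq_abs, sq_abs]
  rw [← Real.rpow_natCast, ← Real.rpow_mul h0]
  norm_num

/-! ### Total variation -/

lemma totalVariation_congr {u v : ℝ → ℝ} (e : u =ᵐ[volume] v) :
    totalVariation u = totalVariation v := by
  unfold totalVariation
  refine iSup_congr fun g => iSup_congr fun _ => ?_
  congr 1
  refine integral_congr_ae ?_
  filter_upwards [e] with x hx
  rw [hx]

lemma totalVariation_zero : totalVariation (fun _ => 0) = 0 := by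
  simp [totalVariation]

lemma le_totalVariation {u g : ℝ → ℝ} (hg : ContDiff ℝ 1 g) (hc : HasCompactSupport g)
    (h1 : ∀ x, |g x| ≤ 1) : ENNReal.ofReal (∫ x, u x * deriv g x) ≤ totalVariation u :=
  le_iSup₂_of_le g ⟨hg, hc, h1⟩ le_rfl

lemma totalVariation_const_mul_le (c : ℝ) (u : ℝ → ℝ) :
    totalVariation (fun x => c * u x) ≤ ENNReal.ofReal |c| * totalVariation u := by
  refine iSup₂_le fun g hg => ?_
  obtain ⟨h1, h2, h3⟩ := hg
  have key : ∀ s : ℝ, |s| = 1 → ∫ x, c * u x * deriv g x = (c * s) * ∫ x, u x * deriv (fun y => s * g y) x := by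
    intro s hs
    rw [← integral_const_mul]
    congr 1; ext x
    rw [deriv_const_mul _ ((h1.differentiable one_ne_zero) x)]
    have : s * s = 1 := by rw [← abs_mul_abs_self, hs, one_mul]
    linear_combination (-(c * u x * deriv g x)) * this
  obtain ⟨s, hs, hcs⟩ : ∃ s : ℝ, |s| = 1 ∧ c * s = |c| := by
    rcases le_total 0 c with h | h
    · exact ⟨1, by simp, by simp [abs_of_nonneg h]⟩
    · exact ⟨-1, by simp, by simp [abs_of_nonpos h]⟩
  rw [key s hs, hcs, ENNReal.ofReal_mul (abs_nonneg c)]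
  gcongr
  refine le_totalVariation (contDiff_const.mul h1) h2.mul_left fun x => ?_
  rw [abs_mul, hs, one_mul]
  exact h3 x

/-! ### Essential variation -/

/-- The test function is a sum of smoothed indicators of `(x k, x (k+1))` with signs `γ k`; it is
bounded by one because the smoothed indicators add up to at most one. -/
lemma sum_bump_le_totalVariation {u : ℝ → ℝ} (hu : Integrable u volume) (φ : ContDiffBump (0 : ℝ))
    (n : ℕ) (x : ℕ → ℝ) (hx : Monotone x) (γ : ℕ → ℝ) (hγ : ∀ k, |γ k| ≤ 1) :
    ENNReal.ofReal (∑ k ∈ Finset.range n, γ k *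
      ((φ.normed volume ⋆[ContinuousLinearMap.lsmul ℝ ℝ, volume] u) (x k) -
        (φ.normed volume ⋆[ContinuousLinearMap.lsmul ℝ ℝ, volume] u) (x (k + 1))))
      ≤ totalVariation u := by
  set η := φ.normed volume with hη
  have hηc : Continuous η := φ.continuous_normed
  have hηi : Integrable η volume := φ.integrable_normed
  have hη0 : ∀ t, 0 ≤ η t := φ.nonneg_normed
  have hη1 : ∫ t, η t = 1 := φ.integral_normed
  have hηout : ∀ t, φ.rOut ≤ |t| → η t = 0 := by
    intro t ht
    have : t ∉ Function.support η := by
      rw [hη, φ.support_normed_eq]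
      simp only [Metric.mem_ball, dist_zero_right, Real.norm_eq_abs, not_lt]
      exact ht
    simpa using this
  let P : ℝ → ℝ := fun y => ∫ t in (0 : ℝ)..y, η t
  have hP : ∀ y, HasDerivAt P (η y) y := fun y =>
    intervalIntegral.integral_hasDerivAt_right (hηc.intervalIntegrable _ _)
      (hηc.stronglyMeasurableAtFilter _ _) hηc.continuousAt
  have hPsub : ∀ a b, P b - P a = ∫ t in a..b, η t := fun a b =>
    intervalIntegral.integral_interval_sub_left (hηc.intervalIntegrable _ _)
      (hηc.intervalIntegrable _ _)
  have hPmono : Monotone P := by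
    intro a b hab
    rw [← sub_nonneg, hPsub]
    exact intervalIntegral.integral_nonneg hab fun t _ => hη0 t
  have hPle : ∀ a b, a ≤ b → P b - P a ≤ 1 := by
    intro a b hab
    rw [hPsub, intervalIntegral.integral_of_le hab, ← hη1]
    exact setIntegral_le_integral hηi (Eventually.of_forall hη0)
  let g : ℝ → ℝ := fun y => ∑ k ∈ Finset.range n, γ k * (P (y - x k) - P (y - x (k + 1)))
  have hg : ∀ y, HasDerivAt g
      (∑ k ∈ Finset.range n, γ k * (η (y - x k) - η (y - x (k + 1)))) y := by
    intro y
    refine HasDerivAt.fun_sum fun k _ => HasDerivAt.const_mul _ ?_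
    exact ((hP _).comp_sub_const y (x k)).sub ((hP _).comp_sub_const y (x (k + 1)))
  have hg' : deriv g = fun y => ∑ k ∈ Finset.range n, γ k * (η (y - x k) - η (y - x (k + 1))) :=
    funext fun y => (hg y).deriv
  have hgC : ContDiff ℝ 1 g := by
    rw [contDiff_one_iff_deriv]
    refine ⟨fun y => (hg y).differentiableAt, ?_⟩
    rw [hg']
    fun_prop
  have hg1 : ∀ y, |g y| ≤ 1 := by
    intro y
    calc |g y| ≤ ∑ k ∈ Finset.range n, |γ k * (P (y - x k) - P (y - x (k + 1)))| :=
          Finset.abs_sum_le_sum_abs _ _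
      _ ≤ ∑ k ∈ Finset.range n, (P (y - x k) - P (y - x (k + 1))) := by
          refine Finset.sum_le_sum fun k _ => ?_
          have h0 : 0 ≤ P (y - x k) - P (y - x (k + 1)) :=
            sub_nonneg.2 (hPmono (by linarith [hx (Nat.le_succ k)]))
          rw [abs_mul, abs_of_nonneg h0]
          exact mul_le_of_le_one_left h0 (hγ k)
      _ = P (y - x 0) - P (y - x n) := Finset.sum_range_sub' (fun k => P (y - x k)) n
      _ ≤ 1 := hPle _ _ (by linarith [hx (Nat.zero_le n)])
  have hgs : HasCompactSupport g := by
    refine HasCompactSupport.intro (isCompact_Icc (a := x 0 - φ.rOut) (b := x n + φ.rOut)) ?_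
    intro y hy
    refine Finset.sum_eq_zero fun k hk => ?_
    have hk : k + 1 ≤ n := Finset.mem_range.1 hk
    have e0 := hx (Nat.zero_le k)
    have e1 := hx (Nat.le_succ k)
    have e2 := hx hk
    rw [hPsub, intervalIntegral.integral_zero_ae, mul_zero]
    refine Eventually.of_forall fun t ht => hηout t ?_
    rw [uIoc_of_le (by simp only [Nat.succ_eq_add_one] at e1; linarith)] at ht
    rw [mem_Icc, not_and_or, not_le, not_le] at hy
    simp only [Nat.succ_eq_add_one] at e1
    rcases hy with hy | hy
    · rw [le_abs]; right; linarith [ht.2]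
    · rw [le_abs]; left; linarith [ht.1]
  have hint : ∀ a, Integrable (fun y => u y * η (y - a)) volume := by
    intro a
    refine hu.mul_bdd (c := (1 : ℝ) * sSup (range fun t => |η t|)) ?_ ?_
    · exact (hηc.comp (continuous_id.sub continuous_const)).aestronglyMeasurable
    · have hb : BddAbove (range fun t => |η t|) :=
        (φ.hasCompactSupport_normed (μ := volume)).norm.exists_bound_of_continuous hηc.norm |>.elim
          fun C hC => ⟨C, by rintro _ ⟨t, rfl⟩; simpa using hC t⟩
      refine Eventually.of_forall fun y => ?_
      rw [one_mul]
      exact le_csSup hb ⟨y - a, rfl⟩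
  have hval : ∀ a, (η ⋆[ContinuousLinearMap.lsmul ℝ ℝ, volume] u) a = ∫ y, u y * η (y - a) := by
    intro a
    rw [convolution_eq_swap]
    congr 1; ext y
    have : η (a - y) = η (y - a) := by rw [hη, ← φ.normed_neg, neg_sub]
    simp only [ContinuousLinearMap.lsmul_apply, smul_eq_mul, this, mul_comm]
  refine le_trans (le_of_eq ?_) (le_totalVariation hgC hgs hg1)
  congr 1
  simp only [hval, hg', Finset.mul_sum]
  rw [integral_finsetSum]
  · refine Finset.sum_congr rfl fun k _ => ?_
    rw [← integral_sub (hint _) (hint _), ← integral_const_mul]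
    congr 1; ext y; ring
  · intro k _
    have := ((hint (x k)).sub (hint (x (k + 1)))).const_mul (γ k)
    refine this.congr (Eventually.of_forall fun y => ?_)
    simp only [Pi.sub_apply]; ring

/-- On a suitable set of full measure, the pointwise variation of an integrable function is at most
its distributional total variation. -/
lemma exists_eVariationOn_le {u : ℝ → ℝ} (hu : Integrable u volume) :
    ∃ A : Set ℝ, (∀ᵐ x, x ∈ A) ∧ eVariationOn u A ≤ totalVariation u := by
  let φ : ℕ → ContDiffBump (0 : ℝ) := fun n =>
    ⟨1 / (n + 1), 2 / (n + 1), by positivity, by gcongr; norm_num⟩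
  have h1 : Tendsto (fun n => (φ n).rOut) atTop (𝓝 0) := by
    have : Tendsto (fun n : ℕ => 2 * (1 / ((n : ℝ) + 1))) atTop (𝓝 (2 * 0)) :=
      tendsto_one_div_add_atTop_nhds_zero_nat.const_mul 2
    rw [mul_zero] at this
    refine this.congr fun n => ?_
    simp only [φ]; ring
  have h2 : ∀ᶠ n in atTop, (φ n).rOut ≤ 2 * (φ n).rIn :=
    Eventually.of_forall fun n => by simp only [φ]; apply le_of_eq; ring
  have h := ContDiffBump.ae_convolution_tendsto_right_of_locallyIntegrable (μ := volume) h1 h2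
    hu.locallyIntegrable
  refine ⟨{x₀ | Tendsto (fun i => ((φ i).normed volume ⋆[ContinuousLinearMap.lsmul ℝ ℝ, volume] u) x₀)
    atTop (𝓝 (u x₀))}, h, ?_⟩
  refine iSup_le ?_
  rintro ⟨n, x, hx, hxA⟩
  simp only [mem_ofPred_eq] at hxA
  let γ : ℕ → ℝ := fun k => SignType.sign (u (x k) - u (x (k + 1)))
  have hγ : ∀ k, |γ k| ≤ 1 := by
    intro k
    simp only [γ]
    cases SignType.sign (u (x k) - u (x (k + 1))) <;> simp
  have key := fun m => sum_bump_le_totalVariation hu (φ m) n x hx γ hγ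
  have hlim : Tendsto (fun m => ENNReal.ofReal (∑ k ∈ Finset.range n, γ k *
      (((φ m).normed volume ⋆[ContinuousLinearMap.lsmul ℝ ℝ, volume] u) (x k) -
        ((φ m).normed volume ⋆[ContinuousLinearMap.lsmul ℝ ℝ, volume] u) (x (k + 1))))) atTop
      (𝓝 (ENNReal.ofReal (∑ k ∈ Finset.range n, γ k * (u (x k) - u (x (k + 1)))))) := by
    refine ENNReal.tendsto_ofReal (tendsto_finsetSum _ fun k _ => ?_)
    exact ((hxA k).sub (hxA (k + 1))).const_mul _
  refine le_trans (le_of_eq ?_) (le_of_tendsto' hlim key)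
  rw [ENNReal.ofReal_sum_of_nonneg]
  · refine Finset.sum_congr rfl fun k _ => ?_
    rw [edist_comm, edist_dist, Real.dist_eq, sign_mul_self]
  · intro k _
    simp only [γ]
    rw [sign_mul_self]
    exact abs_nonneg _

/-- Off a null set the oscillation is at most the total variation. -/
lemma exists_full_dist_le {u : ℝ → ℝ} (hu : Integrable u volume) :
    ∃ A : Set ℝ, (∀ᵐ x, x ∈ A) ∧ ∀ x ∈ A, ∀ y ∈ A, edist (u x) (u y) ≤ totalVariation u := by
  obtain ⟨A, hA, hAv⟩ := exists_eVariationOn_le hu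
  exact ⟨A, hA, fun x hx y hy => (eVariationOn.edist_le u hx hy).trans hAv⟩

/-- An integrable function comes close to zero somewhere, hence is bounded by its variation. -/
lemma ae_enorm_le_totalVariation {u : ℝ → ℝ} (hu : Integrable u volume) :
    ∀ᵐ x, ‖u x‖ₑ ≤ totalVariation u := by
  obtain ⟨A, hA, hd⟩ := exists_full_dist_le hu
  filter_upwards [hA] with x hx
  refine ENNReal.le_of_forall_pos_le_add fun ε hε _ => ?_
  obtain ⟨y, hyA, hy⟩ : ∃ y ∈ A, ‖u y‖ₑ ≤ ε := by
    by_contra! hcon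
    have : volume {y | (ε : ℝ≥0∞) ≤ ‖u y‖ₑ} < ∞ := by
      refine hu.measure_enorm_ge_lt_top ?_ ENNReal.coe_ne_top
      exact_mod_cast hε
    have h2 : volume (univ : Set ℝ) ≤ volume {y | (ε : ℝ≥0∞) ≤ ‖u y‖ₑ} := by
      refine measure_mono_ae ?_
      filter_upwards [hA] with y hy _
      exact (hcon y hy).le
    rw [Real.volume_univ] at h2
    exact absurd this (not_lt.2 h2)
  have := hd x hx y hyA
  calc ‖u x‖ₑ = edist (u x) 0 := by rw [edist_zero_right]
    _ ≤ edist (u x) (u y) + edist (u y) 0 := edist_triangle _ _ _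
    _ ≤ totalVariation u + ε := by rw [edist_zero_right]; gcongr

lemma BV.memLp_top {u : ℝ → ℝ} (hu : u ∈ BV) : MemLp u ∞ volume := by
  refine memLp_top_of_bound hu.1.aestronglyMeasurable (totalVariation u).toReal ?_
  filter_upwards [ae_enorm_le_totalVariation hu.1] with x hx
  have := ENNReal.toReal_mono hu.2.ne hx
  simpa using this

lemma ae_eq_zero_of_totalVariation {u : ℝ → ℝ} (hu : Integrable u volume)
    (h : totalVariation u = 0) : u =ᵐ[volume] fun _ => 0 := by
  filter_upwards [ae_enorm_le_totalVariation hu] with x hx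
  rw [h] at hx
  simpa using hx

/-! ### The functional on bounded integrable functions -/

lemma kernelClass.even {σ : ℝ} {φ : ℝ → ℝ} (h : φ ∈ kernelClass σ) : ∀ᵐ x, φ (-x) = φ x := by
  obtain ⟨-, -, p, -, -, -, e⟩ := h
  have e' := (Measure.measurePreserving_neg (volume : Measure ℝ)).quasiMeasurePreserving.ae e
  filter_upwards [e, e'] with x hx hx'
  rw [hx, hx']
  have h1 : (-x ∈ Icc (-σ) 0) ↔ x ∈ Icc 0 σ := by
    simp only [mem_Icc]; constructor <;> rintro ⟨a, b⟩ <;> constructor <;> linarith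
  have h2 : (-x ∈ Icc 0 σ) ↔ x ∈ Icc (-σ) 0 := by
    simp only [mem_Icc]; constructor <;> rintro ⟨a, b⟩ <;> constructor <;> linarith
  simp only [indicator_apply, h1, h2, neg_neg]
  rw [add_comm]

lemma deblurFunctional_eq {lam : ℝ} (hl : 0 ≤ lam) {φ f u : ℝ → ℝ} (hφ : Integrable φ volume)
    (hf : Integrable f volume) (hf' : MemLp f ∞ volume) (hu : Integrable u volume)
    (hu' : MemLp u ∞ volume) :
    deblurFunctional lam φ f u =
      totalVariation u + ENNReal.ofReal (lam * ∫ x, (conv φ u x - f x) ^ 2) := by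
  have h := memLp_two ((integrable_conv hφ hu).sub hf) ((memLp_top_conv hφ hu hu').sub hf')
  have h2 : eLpNorm (fun x => conv φ u x - f x) 2 volume ^ 2 = _ := eLpNorm_two_sq h
  rw [deblurFunctional, h2, ENNReal.ofReal_mul hl]

lemma integral_sub_sq {a f : ℝ → ℝ} (ha : Integrable a volume) (ha' : MemLp a ∞ volume)
    (hf : Integrable f volume) (hf' : MemLp f ∞ volume) :
    ∫ x, (a x - f x) ^ 2 =
      (∫ x, a x * a x) - 2 * (∫ x, a x * f x) + ∫ x, f x * f x := by
  have e : (fun x => (a x - f x) ^ 2) = fun x => a x * a x - 2 * (a x * f x) + f x * f x := by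
    ext x; ring
  have h1 := integrable_mul_top ha ha'
  have h2 := (integrable_mul_top ha hf').const_mul 2
  have h12 : Integrable (fun x => a x * a x - 2 * (a x * f x)) volume := h1.sub h2
  have h3 := integrable_mul_top hf hf'
  rw [e, integral_add h12 h3, integral_sub h1 h2, integral_const_mul]

lemma starNorm_pairing_le {g u : ℝ → ℝ} {c : ℝ} (hc : 0 ≤ c)
    (h : starNorm g ≤ ENNReal.ofReal c) (hu : u ∈ BV) :
    |∫ x, g x * u x| ≤ c * (totalVariation u).toReal := by
  by_cases h0 : totalVariation u = 0
  · have e := ae_eq_zero_of_totalVariation hu.1 h0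
    have : ∫ x, g x * u x = 0 := by
      rw [← integral_zero ℝ ℝ (μ := volume)]
      refine integral_congr_ae ?_
      filter_upwards [e] with x hx
      rw [hx, mul_zero]
    rw [this, h0]; simp
  · set V := (totalVariation u).toReal with hV
    have hVpos : 0 < V := ENNReal.toReal_pos h0 hu.2.ne
    have hVe : totalVariation u = ENNReal.ofReal V := (ENNReal.ofReal_toReal hu.2.ne).symm
    have h1 : totalVariation (fun x => V⁻¹ * u x) ≤ 1 := by
      refine (totalVariation_const_mul_le _ _).trans (le_of_eq ?_)
      rw [hVe, ← ENNReal.ofReal_mul (abs_nonneg _), abs_of_pos (inv_pos.2 hVpos),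
        inv_mul_cancel₀ hVpos.ne', ENNReal.ofReal_one]
    have h2 : ENNReal.ofReal |∫ x, g x * (V⁻¹ * u x)| ≤ starNorm g :=
      le_iSup₂_of_le (f := fun (v : ℝ → ℝ)
        (_ : v ∈ {v : ℝ → ℝ | Integrable v volume ∧ totalVariation v ≤ 1}) =>
          ENNReal.ofReal |∫ x, g x * v x|) (fun x => V⁻¹ * u x) ⟨hu.1.const_mul _, h1⟩ le_rfl
    have h3 := (ENNReal.ofReal_le_ofReal_iff hc).1 (h2.trans h)
    have h4 : ∫ x, g x * (V⁻¹ * u x) = V⁻¹ * ∫ x, g x * u x := by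
      rw [← integral_const_mul]; congr 1; ext x; ring
    rw [h4, abs_mul, abs_of_pos (inv_pos.2 hVpos), inv_mul_le_iff₀ hVpos] at h3
    linarith

/-- First-order condition along a ray: the quadratic term drops out as `s` tends to zero. -/
lemma le_of_forall_pos_quadratic {A V b : ℝ} (h : ∀ s : ℝ, 0 < s → 0 ≤ s * V - s * A + s ^ 2 * b) :
    A ≤ V := by
  refine le_of_forall_pos_le_add fun ε hε => ?_
  have hs : 0 < ε / (|b| + 1) := by positivity
  have h1 := h _ hs
  set s := ε / (|b| + 1) with hsd
  have h2 : 0 ≤ s * (V - A + s * b) := by linarith [h1, show s * (V - A + s * b) = s * V - s * A + s ^ 2 * b by ring]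
  have h3 := nonneg_of_mul_nonneg_right h2 hs
  have h4 : s * b ≤ ε := by
    calc s * b ≤ s * (|b| + 1) := by gcongr; linarith [le_abs_self b]
      _ = ε := by rw [hsd]; field_simp
  linarith

lemma zero_mem_BV : (fun _ : ℝ => (0 : ℝ)) ∈ BV :=
  ⟨integrable_zero _ _ _, by rw [totalVariation_zero]; exact ENNReal.zero_lt_top⟩

/-- Expanding the square, `0` is the unique minimiser exactly when the linear term
`2 λ ∫ (φ * f) u` never exceeds the total variation of `u`. -/
lemma isUniqueMinimiser_zero_iff {lam : ℝ} (hl : 0 < lam) {φ f : ℝ → ℝ} (hφ : Integrable φ volume)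
    (hev : ∀ᵐ x, φ (-x) = φ x) (hf : Integrable f volume) (hf' : MemLp f ∞ volume) :
    IsUniqueMinimiser (deblurFunctional lam φ f) BV (fun _ => 0) ↔
      starNorm (conv φ f) ≤ ENNReal.ofReal (1 / (2 * lam)) := by
  have hc : (0 : ℝ) ≤ 1 / (2 * lam) := by positivity
  have hF : ∀ u ∈ BV, deblurFunctional lam φ f u = ENNReal.ofReal ((totalVariation u).toReal +
      lam * ((∫ x, conv φ u x * conv φ u x) - 2 * (∫ x, conv φ f x * u x) + ∫ x, f x * f x)) := by
    intro u hu
    have hu' := BV.memLp_top hu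
    rw [deblurFunctional_eq hl.le hφ hf hf' hu.1 hu', ENNReal.ofReal_add ENNReal.toReal_nonneg,
      ENNReal.ofReal_toReal hu.2.ne, integral_sub_sq (integrable_conv hφ hu.1)
        (memLp_top_conv hφ hu.1 hu') hf hf', integral_conv_mul hφ hev hu.1 hf']
    · simp only [mul_comm]
    · have := integral_sub_sq (integrable_conv hφ hu.1) (memLp_top_conv hφ hu.1 hu') hf hf'
      rw [integral_conv_mul hφ hev hu.1 hf'] at this
      simp only [mul_comm (conv φ f _)]
      rw [← this]
      exact mul_nonneg hl.le (integral_nonneg fun x => sq_nonneg _)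
  have hF0 : deblurFunctional lam φ f (fun _ => 0) = ENNReal.ofReal (lam * ∫ x, f x * f x) := by
    rw [hF _ zero_mem_BV, totalVariation_zero]
    simp [conv_apply]
  have hff : 0 ≤ lam * ∫ x, f x * f x :=
    mul_nonneg hl.le (integral_nonneg fun x => mul_self_nonneg _)
  have hcc : ∀ u, 0 ≤ lam * ∫ x, conv φ u x * conv φ u x := fun u =>
    mul_nonneg hl.le (integral_nonneg fun x => mul_self_nonneg _)
  constructor
  · rintro ⟨-, hmin, -⟩
    refine iSup₂_le ?_
    rintro v ⟨hv, hv1⟩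
    have hvB : v ∈ BV := ⟨hv, hv1.trans_lt ENNReal.one_lt_top⟩
    have hV1 : (totalVariation v).toReal ≤ 1 := by
      simpa using ENNReal.toReal_mono ENNReal.one_ne_top hv1
    refine ENNReal.ofReal_le_ofReal ?_
    have key : ∀ c : ℝ, 0 ≤ |c| * (totalVariation v).toReal - c * (2 * lam * ∫ x, conv φ f x * v x)
        + c ^ 2 * (lam * ∫ x, conv φ v x * conv φ v x) := by
      intro c
      have hTV := totalVariation_const_mul_le c v
      have hcB : (fun x => c * v x) ∈ BV :=
        ⟨hv.const_mul c, hTV.trans_lt (ENNReal.mul_lt_top ENNReal.ofReal_lt_top hvB.2)⟩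
      have h1 := isMinOn_iff.1 hmin _ hcB
      have hTV' : (totalVariation fun x => c * v x).toReal ≤ |c| * (totalVariation v).toReal := by
        have := ENNReal.toReal_mono (ENNReal.mul_ne_top ENNReal.ofReal_ne_top hvB.2.ne) hTV
        rwa [ENNReal.toReal_mul, ENNReal.toReal_ofReal (abs_nonneg c)] at this
      rw [hF0, hF _ hcB] at h1
      have e1 : ∫ x, conv φ (fun x => c * v x) x * conv φ (fun x => c * v x) x
          = c ^ 2 * ∫ x, conv φ v x * conv φ v x := by
        rw [← integral_const_mul]; congr 1; ext x; rw [conv_const_mul]; ring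
      have e2 : ∫ x, conv φ f x * (c * v x) = c * ∫ x, conv φ f x * v x := by
        rw [← integral_const_mul]; congr 1; ext x; ring
      rw [e1, e2] at h1
      -- `ENNReal.ofReal` truncates, so the sign of its argument has to be known to compare energies.
      rcases le_or_gt (lam * ∫ x, f x * f x) 0 with h0 | h0
      · have h3 : 0 ≤ ∫ x, (c * conv φ v x - f x) ^ 2 := integral_nonneg fun x => sq_nonneg _
        have h5 := integral_sub_sq (integrable_conv hφ hcB.1)
          (memLp_top_conv hφ hcB.1 (BV.memLp_top hcB)) hf hf'
        rw [integral_conv_mul hφ hev hcB.1 hf', e1] at h5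
        have e3 : ∫ x, c * v x * conv φ f x = c * ∫ x, conv φ f x * v x := by
          rw [← integral_const_mul]; congr 1; ext x; ring
        simp only [conv_const_mul] at h5
        rw [e3] at h5
        rw [h5] at h3
        have h6 := mul_nonneg hl.le h3
        have h7 : 0 ≤ |c| * (totalVariation v).toReal := by positivity
        nlinarith
      · have h2 := (ENNReal.ofReal_le_ofReal_iff' .. |>.1 h1).resolve_right (not_le.2 h0)
        nlinarith
    have hp : 2 * lam * ∫ x, conv φ f x * v x ≤ (totalVariation v).toReal := by
      refine le_of_forall_pos_quadratic (b := lam * ∫ x, conv φ v x * conv φ v x) fun s hs => ?_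
      have := key s
      rwa [abs_of_pos hs] at this
    have hn : -(2 * lam * ∫ x, conv φ f x * v x) ≤ (totalVariation v).toReal := by
      refine le_of_forall_pos_quadratic (b := lam * ∫ x, conv φ v x * conv φ v x) fun s hs => ?_
      have := key (-s)
      rw [abs_neg, abs_of_pos hs, neg_sq] at this
      linarith
    have habs : 2 * lam * |∫ x, conv φ f x * v x| = |2 * lam * ∫ x, conv φ f x * v x| := by
      rw [abs_mul, abs_of_pos (by positivity : (0 : ℝ) < 2 * lam)]
    rw [le_div_iff₀ (by positivity), mul_comm, habs]
    exact (abs_le.2 ⟨by linarith, hp⟩).trans hV1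
  · intro hst
    have key : ∀ u ∈ BV, 2 * lam * ∫ x, conv φ f x * u x ≤ (totalVariation u).toReal := by
      intro u hu
      have h1 := (le_abs_self _).trans (starNorm_pairing_le hc hst hu)
      rw [div_mul_eq_mul_div, one_mul, le_div_iff₀ (by positivity)] at h1
      linarith
    have hle : ∀ u ∈ BV, deblurFunctional lam φ f (fun _ => 0) ≤ deblurFunctional lam φ f u := by
      intro u hu
      rw [hF0, hF u hu]
      refine ENNReal.ofReal_le_ofReal ?_
      have := key u hu
      have := hcc u
      nlinarith
    refine ⟨zero_mem_BV, isMinOn_iff.2 hle, fun v hv hmin => ?_⟩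
    have h1 := isMinOn_iff.1 hmin _ zero_mem_BV
    rw [hF0, hF v hv, ENNReal.ofReal_le_ofReal_iff hff] at h1
    have hk := key v hv
    have hz : lam * ∫ x, conv φ v x * conv φ v x = 0 := le_antisymm (by nlinarith) (hcc v)
    -- the quadratic term vanishes, so `φ * v = 0` and the linear term vanishes as well
    have hz' : ∫ x, conv φ v x * conv φ v x = 0 := (mul_eq_zero.1 hz).resolve_left hl.ne'
    have hvi := integrable_conv hφ hv.1
    have hae : ∀ᵐ x, conv φ v x = 0 := by
      have := (integral_eq_zero_iff_of_nonneg (fun x => mul_self_nonneg (conv φ v x))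
        (integrable_mul_top hvi (memLp_top_conv hφ hv.1 (BV.memLp_top hv)))).1 hz'
      filter_upwards [this] with x hx
      exact mul_self_eq_zero.1 hx
    have hlin : ∫ x, conv φ f x * v x = 0 := by
      have := integral_conv_mul hφ hev hv.1 hf'
      simp only [mul_comm (conv φ f _)]
      rw [← this, ← integral_zero ℝ ℝ (μ := volume)]
      refine integral_congr_ae ?_
      filter_upwards [hae] with x hx
      rw [hx, zero_mul]
    refine ae_eq_zero_of_totalVariation hv.1 ?_
    rw [hlin, hz'] at h1
    have h2 : (totalVariation v).toReal = 0 := le_antisymm (by linarith) ENNReal.toReal_nonneg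
    exact ((ENNReal.toReal_eq_zero_iff _).1 h2).resolve_right hv.2.ne

/-! ### The hat kernel and its primitives -/

lemma hatKernel_eq_max {σ : ℝ} (hσ : 0 < σ) (x : ℝ) : hatKernel σ x = max (σ - |x|) 0 / σ ^ 2 := by
  unfold hatKernel
  split_ifs with h
  · rw [max_eq_left (by linarith)]; field_simp
  · rw [max_eq_right (by linarith)]; simp

lemma hatKernel_eq_second_difference {σ : ℝ} (hσ : 0 < σ) (x : ℝ) :
    hatKernel σ x = (max (x + σ) 0 - 2 * max x 0 + max (x - σ) 0) / σ ^ 2 := by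
  rw [hatKernel_eq_max hσ]
  congr 1
  rcases le_total 0 x with h | h
  · rw [abs_of_nonneg h, max_eq_left h, max_eq_left (by linarith : 0 ≤ x + σ)]
    rcases le_total σ x with h' | h'
    · rw [max_eq_right (by linarith), max_eq_left (by linarith)]; ring
    · rw [max_eq_left (by linarith), max_eq_right (by linarith)]; ring
  · rw [abs_of_nonpos h, max_eq_right h, max_eq_right (by linarith : x - σ ≤ 0)]
    rw [sub_neg_eq_add, add_comm]; ring

lemma hatKernel_nonneg {σ : ℝ} (hσ : 0 < σ) (x : ℝ) : 0 ≤ hatKernel σ x := by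
  rw [hatKernel_eq_max hσ]; positivity

lemma hatKernel_neg (σ x : ℝ) : hatKernel σ (-x) = hatKernel σ x := by
  simp [hatKernel]

lemma hatKernel_eq_zero {σ x : ℝ} (hx : σ ≤ |x|) : hatKernel σ x = 0 := by
  simp [hatKernel, not_lt.2 hx]

lemma hatKernel_anti {σ x y : ℝ} (hσ : 0 < σ) (h : |x| ≤ |y|) : hatKernel σ y ≤ hatKernel σ x := by
  rw [hatKernel_eq_max hσ, hatKernel_eq_max hσ]
  gcongr

lemma continuous_hatKernel {σ : ℝ} (hσ : 0 < σ) : Continuous (hatKernel σ) := by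
  rw [funext (hatKernel_eq_max hσ)]
  fun_prop

lemma integrable_hatKernel {σ : ℝ} (hσ : 0 < σ) : Integrable (hatKernel σ) volume := by
  refine (continuous_hatKernel hσ).integrable_of_hasCompactSupport ?_
  refine HasCompactSupport.intro (isCompact_Icc (a := -σ) (b := σ)) fun x hx => hatKernel_eq_zero ?_
  by_contra! h
  exact hx ⟨(abs_lt.1 h).1.le, (abs_lt.1 h).2.le⟩

lemma hasDerivAt_max_pow (n : ℕ) (a x : ℝ) :
    HasDerivAt (fun y => max (y + a) 0 ^ (n + 2)) ((n + 2) * max (x + a) 0 ^ (n + 1)) x := by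
  have h0 : HasDerivAt (fun y : ℝ => max y 0 ^ (n + 2)) ((n + 2) * max (x + a) 0 ^ (n + 1)) (x + a) := by
    set y := x + a
    rcases lt_trichotomy y 0 with h | h | h
    · rw [max_eq_right h.le]
      refine ((hasDerivAt_const y (0 : ℝ)).congr_of_eventuallyEq ?_).congr_deriv (by simp)
      filter_upwards [Iio_mem_nhds h] with t ht
      rw [max_eq_right (le_of_lt ht)]; simp
    · rw [h]
      simp only [max_self, zero_pow (Nat.succ_ne_zero n), mul_zero]
      rw [hasDerivAt_iff_isLittleO]
      simp only [max_self, zero_pow (Nat.succ_ne_zero _), sub_zero, smul_zero]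
      have h1 : (fun t : ℝ => max t 0 ^ (n + 2)) =O[𝓝 0] fun t => t ^ (n + 2) := by
        refine Asymptotics.IsBigO.of_bound 1 (Eventually.of_forall fun t => ?_)
        rw [one_mul, norm_pow, norm_pow]
        gcongr
        rw [Real.norm_eq_abs, abs_of_nonneg (le_max_right _ _)]
        exact max_le (le_abs_self t) (abs_nonneg t)
      refine h1.trans_isLittleO ?_
      simpa using Asymptotics.isLittleO_pow_pow (𝕜 := ℝ) (show 1 < n + 2 by omega)
    · rw [max_eq_left h.le]
      have h2 := hasDerivAt_pow (n + 2) y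
      refine (h2.congr_of_eventuallyEq ?_).congr_deriv (by push_cast; rfl)
      filter_upwards [Ioi_mem_nhds h] with t ht
      rw [max_eq_left (le_of_lt ht)]
  exact h0.comp_add_const x a

/-- The normalised second difference, with step `σ`, of the function `(x⁺) ^ n`. -/
noncomputable def ramp (σ : ℝ) (n : ℕ) (x : ℝ) : ℝ :=
  (max (x + σ) 0 ^ n - 2 * max x 0 ^ n + max (x - σ) 0 ^ n) / σ ^ 2

lemma hatKernel_eq_ramp {σ : ℝ} (hσ : 0 < σ) : hatKernel σ = ramp σ 1 := by
  ext x; rw [hatKernel_eq_second_difference hσ]; simp [ramp]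

lemma hasDerivAt_ramp (σ : ℝ) (n : ℕ) (x : ℝ) :
    HasDerivAt (ramp σ (n + 2)) ((n + 2) * ramp σ (n + 1) x) x := by
  have h1 := hasDerivAt_max_pow n σ x
  have h2 := hasDerivAt_max_pow n 0 x
  have h3 := hasDerivAt_max_pow n (-σ) x
  simp only [add_zero, ← sub_eq_add_neg] at h2 h3
  refine (((h1.sub (h2.const_mul 2)).add h3).div_const (σ ^ 2)).congr_deriv ?_
  simp only [ramp]; ring

lemma continuous_ramp (σ : ℝ) (n : ℕ) : Continuous (ramp σ n) := by
  unfold ramp; fun_prop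

lemma ramp_eq_zero {σ x : ℝ} (hσ : 0 < σ) (n : ℕ) (hx : x ≤ -σ) : ramp σ (n + 1) x = 0 := by
  unfold ramp
  rw [max_eq_right (by linarith), max_eq_right (by linarith), max_eq_right (by linarith)]
  simp

/-- The distribution function of the hat kernel. -/
noncomputable def hatCdf (σ x : ℝ) : ℝ := ramp σ 2 x / 2

lemma continuous_hatCdf (σ : ℝ) : Continuous (hatCdf σ) := (continuous_ramp σ 2).div_const 2

lemma hasDerivAt_hatCdf {σ : ℝ} (hσ : 0 < σ) (x : ℝ) :
    HasDerivAt (hatCdf σ) (hatKernel σ x) x := by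
  refine ((hasDerivAt_ramp σ 0 x).div_const 2).congr_deriv ?_
  rw [hatKernel_eq_ramp hσ]; simp

lemma hatCdf_eq_zero {σ x : ℝ} (hσ : 0 < σ) (hx : x ≤ -σ) : hatCdf σ x = 0 := by
  rw [hatCdf, ramp_eq_zero hσ 1 hx, zero_div]

lemma hatCdf_add_neg {σ : ℝ} (hσ : 0 < σ) (x : ℝ) : hatCdf σ x + hatCdf σ (-x) = 1 := by
  have key : ∀ a : ℝ, max a 0 ^ 2 + max (-a) 0 ^ 2 = a ^ 2 := by
    intro a
    rcases le_total 0 a with h | h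
    · rw [max_eq_left h, max_eq_right (by linarith)]; ring
    · rw [max_eq_right h, max_eq_left (by linarith)]; ring
  have h1 := key (x + σ)
  have h2 := key x
  have h3 := key (x - σ)
  have : (2 * σ ^ 2) * (hatCdf σ x + hatCdf σ (-x)) = 2 * σ ^ 2 := by
    unfold hatCdf ramp
    rw [show -x + σ = -(x - σ) by ring, show -x - σ = -(x + σ) by ring]
    field_simp
    linear_combination h1 - 2 * h2 + h3
  have h0 : (2 * σ ^ 2) ≠ 0 := by positivity
  exact mul_left_cancel₀ h0 (by rw [this, mul_one])

lemma monotone_hatCdf {σ : ℝ} (hσ : 0 < σ) : Monotone (hatCdf σ) := by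
  refine monotone_of_deriv_nonneg (fun x => (hasDerivAt_hatCdf hσ x).differentiableAt) fun x => ?_
  rw [(hasDerivAt_hatCdf hσ x).deriv]
  exact hatKernel_nonneg hσ x

lemma hatCdf_nonneg {σ : ℝ} (hσ : 0 < σ) (x : ℝ) : 0 ≤ hatCdf σ x := by
  rw [← hatCdf_eq_zero hσ (min_le_right x (-σ))]
  exact monotone_hatCdf hσ (min_le_left _ _)

lemma hatCdf_le_one {σ : ℝ} (hσ : 0 < σ) (x : ℝ) : hatCdf σ x ≤ 1 := by
  linarith [hatCdf_add_neg hσ x, hatCdf_nonneg hσ (-x)]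

lemma memLp_top_hatCdf {σ : ℝ} (hσ : 0 < σ) (t : ℝ) :
    MemLp (fun x => hatCdf σ (x - t)) ∞ volume := by
  refine memLp_top_of_bound
    ((continuous_hatCdf σ).comp (continuous_id.sub continuous_const)).aestronglyMeasurable 1
    (Eventually.of_forall fun x => ?_)
  rw [Real.norm_eq_abs, abs_of_nonneg (hatCdf_nonneg hσ _)]
  exact hatCdf_le_one hσ _

lemma tendsto_hatCdf_atBot {σ : ℝ} (hσ : 0 < σ) : Tendsto (hatCdf σ) atBot (𝓝 0) := by
  refine tendsto_const_nhds.congr' ?_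
  filter_upwards [eventually_le_atBot (-σ)] with x hx
  rw [hatCdf_eq_zero hσ hx]

lemma integral_hatKernel {σ : ℝ} (hσ : 0 < σ) : ∫ x, hatKernel σ x = 1 := by
  have h1 : Tendsto (hatCdf σ) atTop (𝓝 1) := by
    refine tendsto_const_nhds.congr' ?_
    filter_upwards [eventually_ge_atTop σ] with x hx
    have := hatCdf_add_neg hσ x
    rw [hatCdf_eq_zero hσ (by linarith : -x ≤ -σ)] at this
    linarith
  have := integral_of_hasDerivAt_of_tendsto (fun x => hasDerivAt_hatCdf hσ x)
    (integrable_hatKernel hσ) (tendsto_hatCdf_atBot hσ) h1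
  rw [this, sub_zero]

lemma conv_hatKernel_const {σ : ℝ} (hσ : 0 < σ) (c x : ℝ) :
    conv (hatKernel σ) (fun _ => c) x = c := by
  rw [conv_apply, integral_mul_const, integral_hatKernel hσ, one_mul]

/-- The Heaviside function with its jump at `t`. -/
noncomputable def step (t : ℝ) : ℝ → ℝ := (Ioi t).indicator fun _ => 1

lemma step_nonneg (t x : ℝ) : 0 ≤ step t x := indicator_nonneg (fun _ _ => zero_le_one) x

lemma step_le_one (t x : ℝ) : step t x ≤ 1 := indicator_le_self' (fun _ _ => zero_le_one) x

lemma memLp_top_step (t : ℝ) : MemLp (step t) ∞ volume := by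
  refine memLp_top_of_bound (measurable_const.indicator measurableSet_Ioi).aestronglyMeasurable 1
    (Eventually.of_forall fun x => ?_)
  rw [Real.norm_eq_abs, abs_of_nonneg (step_nonneg t x)]
  exact step_le_one t x

lemma conv_hatKernel_step {σ : ℝ} (hσ : 0 < σ) (t x : ℝ) :
    conv (hatKernel σ) (step t) x = hatCdf σ (x - t) := by
  have h1 : conv (hatKernel σ) (step t) x = ∫ y in Iio (x - t), hatKernel σ y := by
    rw [conv_apply, ← integral_indicator measurableSet_Iio]
    congr 1; ext y
    by_cases h : y < x - t
    · rw [indicator_of_mem (mem_Iio.2 h), step, indicator_of_mem (mem_Ioi.2 (by linarith)), mul_one]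
    · rw [indicator_of_notMem (by simpa using h), step,
        indicator_of_notMem (by rw [mem_Ioi]; linarith), mul_zero]
  rw [h1, ← integral_Iic_eq_integral_Iio,
    integral_Iic_of_hasDerivAt_of_tendsto (continuous_hatCdf σ).continuousWithinAt
      (fun y _ => hasDerivAt_hatCdf hσ y) (integrable_hatKernel hσ).integrableOn
      (tendsto_hatCdf_atBot hσ), sub_zero]

/-- Convolution with the hat kernel takes the second difference of a second primitive. -/
lemma conv_hatKernel_of_hasDerivAt {ρ : ℝ} (hρ : 0 < ρ) {G G₁ g : ℝ → ℝ}
    (hG : ∀ x, HasDerivAt G (G₁ x) x) (hG₁ : ∀ x, HasDerivAt G₁ (g x) x) (hg : Continuous g)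
    (x : ℝ) : conv (hatKernel ρ) g x = (G (x + ρ) - 2 * G x + G (x - ρ)) / ρ ^ 2 := by
  have hc : Continuous fun t => hatKernel ρ t * g (x - t) :=
    (continuous_hatKernel hρ).mul (hg.comp (continuous_const.sub continuous_id))
  have hd : ∀ t, HasDerivAt (fun t => G (x - t)) (-G₁ (x - t)) t := fun t => by
    simpa using (hG (x - t)).comp_const_sub x t
  have hd₁ : ∀ t, HasDerivAt (fun t => G₁ (x - t)) (-g (x - t)) t := fun t => by
    simpa using (hG₁ (x - t)).comp_const_sub x t
  have h1 : conv (hatKernel ρ) g x = ∫ t in (-ρ)..ρ, hatKernel ρ t * g (x - t) := by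
    rw [conv_apply, intervalIntegral.integral_of_le (by linarith)]
    refine (setIntegral_eq_integral_of_forall_compl_eq_zero fun t ht => ?_).symm
    rw [hatKernel_eq_zero, zero_mul]
    by_contra! h
    exact ht ⟨(abs_lt.1 h).1, (abs_lt.1 h).2.le⟩
  have h2 : ∫ t in (-ρ)..0, hatKernel ρ t * g (x - t) =
      (-(ρ + 0) * G₁ (x - 0) - G (x - 0)) / ρ ^ 2
        - (-(ρ + -ρ) * G₁ (x - -ρ) - G (x - -ρ)) / ρ ^ 2 := by
    refine intervalIntegral.integral_eq_sub_of_hasDerivAt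
      (f := fun t => (-(ρ + t) * G₁ (x - t) - G (x - t)) / ρ ^ 2) (fun t ht => ?_)
      (hc.intervalIntegrable _ _)
    rw [uIcc_of_le (by linarith)] at ht
    have e := (((((hasDerivAt_id t).const_add ρ).neg).mul (hd₁ t)).sub (hd t)).div_const (ρ ^ 2)
    refine e.congr_deriv ?_
    rw [hatKernel_eq_max hρ, abs_of_nonpos ht.2, max_eq_left (by linarith [ht.1])]
    simp only [Pi.neg_apply, id_eq]
    ring
  have h3 : ∫ t in (0 : ℝ)..ρ, hatKernel ρ t * g (x - t) =
      (-(ρ - ρ) * G₁ (x - ρ) + G (x - ρ)) / ρ ^ 2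
        - (-(ρ - 0) * G₁ (x - 0) + G (x - 0)) / ρ ^ 2 := by
    refine intervalIntegral.integral_eq_sub_of_hasDerivAt
      (f := fun t => (-(ρ - t) * G₁ (x - t) + G (x - t)) / ρ ^ 2) (fun t ht => ?_)
      (hc.intervalIntegrable _ _)
    rw [uIcc_of_le hρ.le] at ht
    have e := (((((hasDerivAt_id t).const_sub ρ).neg).mul (hd₁ t)).add (hd t)).div_const (ρ ^ 2)
    refine e.congr_deriv ?_
    rw [hatKernel_eq_max hρ, abs_of_nonneg ht.1, max_eq_left (by linarith [ht.2])]
    simp only [Pi.neg_apply, id_eq]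
    ring
  rw [h1, ← intervalIntegral.integral_add_adjacent_intervals (b := 0) (hc.intervalIntegrable _ _)
    (hc.intervalIntegrable _ _), h2, h3]
  simp only [sub_zero, sub_neg_eq_add]
  ring

/-! ### The distribution function of a sum of two hat variables -/

/-- The distribution function of the density `hatKernel ρ * hatKernel σ`. -/
noncomputable def hatCdf₂ (ρ σ : ℝ) : ℝ → ℝ := conv (hatKernel ρ) (hatCdf σ)

lemma hatCdf₂_eq {ρ : ℝ} (hρ : 0 < ρ) (σ x : ℝ) :
    hatCdf₂ ρ σ x = (ramp σ 4 (x + ρ) - 2 * ramp σ 4 x + ramp σ 4 (x - ρ)) / (24 * ρ ^ 2) := by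
  have h := conv_hatKernel_of_hasDerivAt hρ (G := fun x => ramp σ 4 x / 24)
    (G₁ := fun x => ramp σ 3 x / 6) (g := hatCdf σ)
    (fun x => ((hasDerivAt_ramp σ 2 x).div_const 24).congr_deriv (by push_cast; ring))
    (fun x => ((hasDerivAt_ramp σ 1 x).div_const 6).congr_deriv (by
      rw [hatCdf]; push_cast; ring)) (continuous_hatCdf σ) x
  rw [hatCdf₂, h]
  field_simp

lemma continuous_hatCdf₂ {ρ : ℝ} (hρ : 0 < ρ) (σ : ℝ) : Continuous (hatCdf₂ ρ σ) := by
  rw [funext (hatCdf₂_eq hρ σ)]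
  have := continuous_ramp σ 4
  fun_prop

lemma conv_hatCdf_sub (ρ σ t x : ℝ) :
    conv (hatKernel ρ) (fun y => hatCdf σ (y - t)) x = hatCdf₂ ρ σ (x - t) := by
  rw [hatCdf₂, conv_apply, conv_apply]
  congr 1; ext y; congr 2; ring

lemma memLp_top_hatCdf' {σ : ℝ} (hσ : 0 < σ) : MemLp (hatCdf σ) ∞ volume := by
  simpa using memLp_top_hatCdf hσ 0

lemma hatCdf₂_nonneg {ρ σ : ℝ} (hρ : 0 < ρ) (hσ : 0 < σ) (x : ℝ) : 0 ≤ hatCdf₂ ρ σ x :=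
  conv_nonneg (hatKernel_nonneg hρ) (hatCdf_nonneg hσ) x

lemma hatCdf₂_add_neg {ρ σ : ℝ} (hρ : 0 < ρ) (hσ : 0 < σ) (x : ℝ) :
    hatCdf₂ ρ σ x + hatCdf₂ ρ σ (-x) = 1 := by
  have h1 : hatCdf₂ ρ σ (-x) = ∫ t, hatKernel ρ t * (1 - hatCdf σ (x - t)) := by
    rw [hatCdf₂, conv_apply, ← integral_neg_eq_self]
    congr 1; ext t
    rw [hatKernel_neg, ← hatCdf_add_neg hσ (x - t)]
    congr 1
    rw [show -x - -t = -(x - t) by ring]; ring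
  have h2 : ∫ t, hatKernel ρ t * (1 - hatCdf σ (x - t)) = 1 - hatCdf₂ ρ σ x := by
    have := conv_sub (integrable_hatKernel hρ) (memLp_top_const (1 : ℝ)) (memLp_top_hatCdf' hσ) x
    rw [conv_hatKernel_const hρ] at this
    exact this
  rw [h1, h2]; ring

lemma hatCdf₂_le_one {ρ σ : ℝ} (hρ : 0 < ρ) (hσ : 0 < σ) (x : ℝ) : hatCdf₂ ρ σ x ≤ 1 := by
  linarith [hatCdf₂_add_neg hρ hσ x, hatCdf₂_nonneg hρ hσ (-x)]

lemma hatCdf₂_eq_zero {ρ σ x : ℝ} (hσ : 0 < σ) (hx : x ≤ -(ρ + σ)) : hatCdf₂ ρ σ x = 0 := by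
  rw [hatCdf₂, conv_apply, ← integral_zero ℝ ℝ (μ := volume)]
  congr 1; ext t
  by_cases ht : ρ ≤ |t|
  · rw [hatKernel_eq_zero ht, zero_mul]
  · have := (abs_lt.1 (not_le.1 ht)).1
    rw [hatCdf_eq_zero hσ (by linarith), mul_zero]

lemma hatCdf₂_eq_one {ρ σ x : ℝ} (hρ : 0 < ρ) (hσ : 0 < σ) (hx : ρ + σ ≤ x) :
    hatCdf₂ ρ σ x = 1 := by
  have := hatCdf₂_add_neg hρ hσ x
  rw [hatCdf₂_eq_zero hσ (by linarith : -x ≤ -(ρ + σ))] at this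
  linarith

lemma memLp_top_hatCdf₂ {ρ σ : ℝ} (hρ : 0 < ρ) (hσ : 0 < σ) (t : ℝ) :
    MemLp (fun x => hatCdf₂ ρ σ (x - t)) ∞ volume := by
  refine memLp_top_of_bound
    ((continuous_hatCdf₂ hρ σ).comp (continuous_id.sub continuous_const)).aestronglyMeasurable 1
    (Eventually.of_forall fun x => ?_)
  rw [Real.norm_eq_abs, abs_of_nonneg (hatCdf₂_nonneg hρ hσ _)]
  exact hatCdf₂_le_one hρ hσ _

lemma hatCdf_of_nonpos {σ x : ℝ} (hσ : 0 < σ) (hx : x ≤ 0) :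
    hatCdf σ x = (max (x + σ) 0 / σ) ^ 2 / 2 := by
  rw [hatCdf, ramp, max_eq_right hx, max_eq_right (by linarith : x - σ ≤ 0)]
  ring

lemma hatCdf_le_of_le {ρ σ x : ℝ} (hσ : 0 < σ) (h : σ ≤ ρ) (hx : x ≤ 0) :
    hatCdf σ x ≤ hatCdf ρ x := by
  have hρ := hσ.trans_le h
  rw [hatCdf_of_nonpos hσ hx, hatCdf_of_nonpos hρ hx]
  refine div_le_div_of_nonneg_right (pow_le_pow_left₀ (by positivity) ?_ 2) zero_le_two
  rw [div_le_div_iff₀ hσ hρ]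
  rcases le_total (x + σ) 0 with h1 | h1
  · rw [max_eq_right h1, zero_mul]; positivity
  · rw [max_eq_left h1, max_eq_left (by linarith)]
    nlinarith

/-- Widening the second kernel makes the distribution function larger on the left half line: the
difference of the two distribution functions is odd, and convolving an odd function of constant
sign on a half line with a symmetric unimodal kernel keeps that sign. -/
lemma hatCdf₂_le_of_le {ρ σ x : ℝ} (hσ : 0 < σ) (h : σ ≤ ρ) (hx : x ≤ 0) :
    hatCdf₂ ρ σ x ≤ hatCdf₂ ρ ρ x := by
  have hρ := hσ.trans_le h
  set c : ℝ → ℝ := fun y => hatCdf ρ y - hatCdf σ y with hc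
  have hodd : ∀ y, c (-y) = -c y := fun y => by
    have h1 := hatCdf_add_neg hρ y
    have h2 := hatCdf_add_neg hσ y
    simp only [hc]; linarith
  have hcm : MemLp c ∞ volume := (memLp_top_hatCdf' hρ).sub (memLp_top_hatCdf' hσ)
  have h1 : conv (hatKernel ρ) c x = hatCdf₂ ρ ρ x - hatCdf₂ ρ σ x :=
    conv_sub (integrable_hatKernel hρ) (memLp_top_hatCdf' hρ) (memLp_top_hatCdf' hσ) x
  have hi : Integrable (fun y => hatKernel ρ (x - y) * c y) volume := by
    have := (integrable_conv_integrand (integrable_hatKernel hρ) hcm x).comp_sub_left x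
    simpa using this
  have h2 : conv (hatKernel ρ) c x = ∫ y, hatKernel ρ (x - y) * c y := conv_apply_swap _ _ _
  have h3 : conv (hatKernel ρ) c x = ∫ y, hatKernel ρ (x - -y) * c (-y) := by
    rw [h2, ← integral_neg_eq_self]
  have h4 : 2 * conv (hatKernel ρ) c x =
      ∫ y, (hatKernel ρ (x - y) * c y + hatKernel ρ (x - -y) * c (-y)) := by
    rw [integral_add hi hi.comp_neg, ← h2, ← h3]; ring
  have h5 : 0 ≤ 2 * conv (hatKernel ρ) c x := by
    rw [h4]
    refine integral_nonneg fun y => ?_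
    simp only [Pi.zero_apply]
    rw [hodd, sub_neg_eq_add]
    have : 0 ≤ (hatKernel ρ (x - y) - hatKernel ρ (x + y)) * c y := by
      rcases le_total y 0 with hy | hy
      · refine mul_nonneg (sub_nonneg.2 (hatKernel_anti hρ ?_))
          (sub_nonneg.2 (hatCdf_le_of_le hσ h hy))
        rw [abs_of_nonpos (by linarith : x + y ≤ 0)]
        exact abs_le.2 ⟨by linarith, by linarith⟩
      · refine mul_nonneg_of_nonpos_of_nonpos (sub_nonpos.2 (hatKernel_anti hρ ?_)) ?_
        · rw [abs_of_nonpos (by linarith : x - y ≤ 0)]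
          exact abs_le.2 ⟨by linarith, by linarith⟩
        · have := hodd (-y)
          rw [neg_neg] at this
          have h7 := hatCdf_le_of_le hσ h (by linarith : -y ≤ 0)
          rw [this]; simp only [hc]; linarith
    linarith
  linarith

lemma hatCdf₂_ge_of_le {ρ σ x : ℝ} (hσ : 0 < σ) (h : σ ≤ ρ) (hx : 0 ≤ x) :
    hatCdf₂ ρ ρ x ≤ hatCdf₂ ρ σ x := by
  have hρ := hσ.trans_le h
  have h1 := hatCdf₂_add_neg hρ hσ x
  have h2 := hatCdf₂_add_neg hρ hρ x
  have h3 := hatCdf₂_le_of_le hσ h (by linarith : -x ≤ 0)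
  linarith

/-- Half the mean of `|X + Y|` for independent `X`, `Y` with densities `hatKernel ρ`,
`hatKernel σ`, where `σ ≤ ρ`. -/
noncomputable def halfMeanAbs (ρ σ : ℝ) : ℝ := ρ / 6 + σ ^ 2 / (12 * ρ) - σ ^ 3 / (60 * ρ ^ 2)

lemma integrableOn_hatCdf₂ {ρ σ : ℝ} (hρ : 0 < ρ) (hσ : 0 < σ) :
    IntegrableOn (hatCdf₂ ρ σ) (Iic 0) volume := by
  have h1 : IntegrableOn (hatCdf₂ ρ σ) (Icc (-(ρ + σ)) 0) volume :=
    (continuous_hatCdf₂ hρ σ).integrableOn_Icc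
  refine h1.of_forall_sdiff_eq_zero measurableSet_Iic fun x hx => hatCdf₂_eq_zero hσ ?_
  by_contra! h
  exact hx.2 ⟨h.le, hx.1⟩

lemma integral_hatCdf₂ {ρ σ : ℝ} (hσ : 0 < σ) (h : σ ≤ ρ) :
    ∫ x in Iic 0, hatCdf₂ ρ σ x = halfMeanAbs ρ σ := by
  have hρ := hσ.trans_le h
  let V : ℝ → ℝ := fun x => (ramp σ 5 (x + ρ) - 2 * ramp σ 5 x + ramp σ 5 (x - ρ)) / (120 * ρ ^ 2)
  have hV : ∀ x, HasDerivAt V (hatCdf₂ ρ σ x) x := by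
    intro x
    have h1 := (hasDerivAt_ramp σ 3 (x + ρ)).comp_add_const x ρ
    have h2 := hasDerivAt_ramp σ 3 x
    have h3 := (hasDerivAt_ramp σ 3 (x - ρ)).comp_sub_const x ρ
    refine (((h1.sub (h2.const_mul 2)).add h3).div_const (120 * ρ ^ 2)).congr_deriv ?_
    rw [hatCdf₂_eq hρ]
    push_cast
    field_simp
    ring
  have hlim : Tendsto V atBot (𝓝 0) := by
    refine tendsto_const_nhds.congr' ?_
    filter_upwards [eventually_le_atBot (-(ρ + σ))] with x hx
    simp only [V]
    rw [ramp_eq_zero hσ 4 (by linarith), ramp_eq_zero hσ 4 (by linarith),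
      ramp_eq_zero hσ 4 (by linarith)]
    simp
  rw [integral_Iic_of_hasDerivAt_of_tendsto (hV 0).continuousAt.continuousWithinAt
    (fun x _ => hV x) (integrableOn_hatCdf₂ hρ hσ) hlim, sub_zero]
  simp only [V, ramp, zero_add, zero_sub, max_self]
  rw [max_eq_left (by linarith : 0 ≤ ρ + σ), max_eq_left hρ.le, max_eq_left (by linarith : 0 ≤ ρ - σ),
    max_eq_left hσ.le, max_eq_right (by linarith : -σ ≤ 0), max_eq_right (by linarith : -ρ + σ ≤ 0),
    max_eq_right (by linarith : -ρ ≤ 0), max_eq_right (by linarith : -ρ - σ ≤ 0), halfMeanAbs]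
  field_simp
  ring

/-! ### Interaction energies of sets and jumps -/

/-- The real indicator function of a set. -/
noncomputable abbrev ind (A : Set ℝ) : ℝ → ℝ := A.indicator fun _ => 1

lemma ind_nonneg (A : Set ℝ) (x : ℝ) : 0 ≤ ind A x := indicator_nonneg (fun _ _ => zero_le_one) x

lemma ind_le_one (A : Set ℝ) (x : ℝ) : ind A x ≤ 1 := indicator_le_self' (fun _ _ => zero_le_one) x

lemma integrable_ind {A : Set ℝ} (hA : MeasurableSet A) (hv : volume A < ∞) :
    Integrable (ind A) volume :=
  (integrable_indicator_iff hA).2 (integrableOn_const hv.ne)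

lemma memLp_top_ind {A : Set ℝ} (hA : MeasurableSet A) : MemLp (ind A) ∞ volume := by
  refine memLp_top_of_bound (measurable_const.indicator hA).aestronglyMeasurable 1
    (Eventually.of_forall fun x => ?_)
  rw [Real.norm_eq_abs, abs_of_nonneg (ind_nonneg A x)]
  exact ind_le_one A x

/-- The interaction `∫ (φ * 1_A) (φ * 1_B)` of two sets, with `φ` the hat kernel of size `ρ`. -/
noncomputable def interaction (ρ : ℝ) (A B : Set ℝ) : ℝ :=
  ∫ x, conv (hatKernel ρ) (ind A) x * conv (hatKernel ρ) (ind B) x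

/-- The interaction `∫ (φ_ρ * 1_A) (φ_σ * H)` of a set with the step `H` at `t`. -/
noncomputable def stepInteraction (ρ σ : ℝ) (A : Set ℝ) (t : ℝ) : ℝ :=
  ∫ x, conv (hatKernel ρ) (ind A) x * hatCdf σ (x - t)

section Pairings

variable {ρ σ t : ℝ} {A B : Set ℝ}

lemma integrable_conv_ind (hρ : 0 < ρ) (hA : MeasurableSet A) (hv : volume A < ∞) :
    Integrable (conv (hatKernel ρ) (ind A)) volume :=
  integrable_conv (integrable_hatKernel hρ) (integrable_ind hA hv)

lemma memLp_top_conv_ind (hρ : 0 < ρ) (hA : MeasurableSet A) (hv : volume A < ∞) :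
    MemLp (conv (hatKernel ρ) (ind A)) ∞ volume :=
  memLp_top_conv (integrable_hatKernel hρ) (integrable_ind hA hv) (memLp_top_ind hA)

lemma conv_ind_nonneg (hρ : 0 < ρ) (A : Set ℝ) (x : ℝ) : 0 ≤ conv (hatKernel ρ) (ind A) x :=
  conv_nonneg (hatKernel_nonneg hρ) (ind_nonneg A) x

lemma interaction_comm (ρ : ℝ) (A B : Set ℝ) : interaction ρ A B = interaction ρ B A := by
  simp only [interaction, mul_comm]

lemma stepInteraction_eq (hρ : 0 < ρ) (hσ : 0 < σ) (hA : MeasurableSet A) (hv : volume A < ∞)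
    (t : ℝ) : stepInteraction ρ σ A t = ∫ x in A, hatCdf₂ ρ σ (x - t) := by
  rw [stepInteraction, integral_conv_mul (integrable_hatKernel hρ)
    (Eventually.of_forall (hatKernel_neg ρ)) (integrable_ind hA hv) (memLp_top_hatCdf hσ t),
    ← integral_indicator hA]
  congr 1; ext x
  rw [conv_hatCdf_sub]
  by_cases h : x ∈ A <;> simp [h]

lemma integrableOn_hatCdf₂_sub (hρ : 0 < ρ) (hσ : 0 < σ) (hA : MeasurableSet A)
    (hv : volume A < ∞) (t : ℝ) : IntegrableOn (fun x => hatCdf₂ ρ σ (x - t)) A volume := by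
  rw [← integrable_indicator_iff hA]
  refine (integrable_mul_top (integrable_ind hA hv) (memLp_top_hatCdf₂ hρ hσ t)).congr
    (Eventually.of_forall fun x => ?_)
  by_cases h : x ∈ A <;> simp [h]

lemma setIntegral_hatCdf₂_le (hσ : 0 < σ) (h : σ ≤ ρ)
    (ht : A ⊆ Iic t) : ∫ x in A, hatCdf₂ ρ σ (x - t) ≤ halfMeanAbs ρ σ := by
  have hρ := hσ.trans_le h
  have hi : IntegrableOn (fun x => hatCdf₂ ρ σ (x - t)) (Iic t) volume := by
    have h1 := (integrable_indicator_iff measurableSet_Iic).2 (integrableOn_hatCdf₂ hρ hσ)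
    rw [← integrable_indicator_iff measurableSet_Iic]
    refine (h1.comp_sub_right t).congr (Eventually.of_forall fun x => ?_)
    by_cases hx : x ≤ t
    · simp [hx]
    · simp [hx]
  have e : ∫ x in Iic t, hatCdf₂ ρ σ (x - t) = halfMeanAbs ρ σ := by
    rw [← integral_hatCdf₂ hσ h, ← integral_indicator measurableSet_Iic,
      ← integral_indicator measurableSet_Iic,
      ← integral_sub_right_eq_self (fun x => (Iic (0 : ℝ)).indicator (hatCdf₂ ρ σ) x) t]
    congr 1; ext x
    by_cases hx : x ≤ t
    · simp [hx]
    · simp [hx]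
  rw [← e]
  exact setIntegral_mono_set hi (Eventually.of_forall fun x => hatCdf₂_nonneg hρ hσ _)
    ht.eventuallyLE

lemma setIntegral_hatCdf₂_neg_le (hσ : 0 < σ) (h : σ ≤ ρ) (hA : MeasurableSet A)
    (ht : A ⊆ Ici t) : ∫ x in A, hatCdf₂ ρ σ (t - x) ≤ halfMeanAbs ρ σ := by
  have h1 := setIntegral_hatCdf₂_le hσ h (A := -A) (t := -t) (fun x hx => by
    have := ht (mem_neg.1 hx)
    rw [mem_Ici] at this
    rw [mem_Iic]; linarith)
  refine le_trans (le_of_eq ?_) h1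
  rw [← integral_indicator hA, ← integral_indicator hA.neg, ← integral_neg_eq_self]
  congr 1; ext x
  by_cases hx : -x ∈ A
  · rw [indicator_of_mem hx, indicator_of_mem (mem_neg.2 hx)]
    congr 1; ring
  · rw [indicator_of_notMem hx, indicator_of_notMem (by simpa using hx)]

lemma halfMeanAbs_nonneg (hσ : 0 < σ) (h : σ ≤ ρ) : 0 ≤ halfMeanAbs ρ σ := by
  rw [← integral_hatCdf₂ hσ h]
  exact setIntegral_nonneg measurableSet_Iic fun x _ => hatCdf₂_nonneg (hσ.trans_le h) hσ x

lemma stepInteraction_le_of_subset_Iic (hσ : 0 < σ) (h : σ ≤ ρ) (hA : MeasurableSet A)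
    (hv : volume A < ∞) (ht : A ⊆ Iic t) :
    stepInteraction ρ σ A t ≤ stepInteraction ρ ρ A t := by
  have hρ := hσ.trans_le h
  rw [stepInteraction_eq hρ hσ hA hv, stepInteraction_eq hρ hρ hA hv]
  refine setIntegral_mono_on (integrableOn_hatCdf₂_sub hρ hσ hA hv t)
    (integrableOn_hatCdf₂_sub hρ hρ hA hv t) hA fun x hx => hatCdf₂_le_of_le hσ h ?_
  have := ht hx
  rw [mem_Iic] at this
  linarith

lemma stepInteraction_le_of_subset_Ici (hσ : 0 < σ) (h : σ ≤ ρ) (hA : MeasurableSet A)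
    (hv : volume A < ∞) (ht : A ⊆ Ici t) :
    stepInteraction ρ ρ A t ≤ stepInteraction ρ σ A t := by
  have hρ := hσ.trans_le h
  rw [stepInteraction_eq hρ hσ hA hv, stepInteraction_eq hρ hρ hA hv]
  refine setIntegral_mono_on (integrableOn_hatCdf₂_sub hρ hρ hA hv t)
    (integrableOn_hatCdf₂_sub hρ hσ hA hv t) hA fun x hx => hatCdf₂_ge_of_le hσ h ?_
  have := ht hx
  rw [mem_Ici] at this
  linarith

lemma stepInteraction_eq_of_le (hσ : 0 < σ) (h : σ ≤ ρ) (hA : MeasurableSet A)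
    (hv : volume A < ∞) (ht : A ⊆ Iic (t - 2 * ρ)) :
    stepInteraction ρ ρ A t = stepInteraction ρ σ A t := by
  have hρ := hσ.trans_le h
  rw [stepInteraction_eq hρ hσ hA hv, stepInteraction_eq hρ hρ hA hv]
  refine setIntegral_congr_fun hA fun x hx => ?_
  have := ht hx
  rw [mem_Iic] at this
  rw [hatCdf₂_eq_zero hσ (by linarith), hatCdf₂_eq_zero hρ (by linarith)]

lemma stepInteraction_eq_of_ge (hσ : 0 < σ) (h : σ ≤ ρ) (hA : MeasurableSet A)
    (hv : volume A < ∞) (ht : A ⊆ Ici (t + 2 * ρ)) :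
    stepInteraction ρ ρ A t = stepInteraction ρ σ A t := by
  have hρ := hσ.trans_le h
  rw [stepInteraction_eq hρ hσ hA hv, stepInteraction_eq hρ hρ hA hv]
  refine setIntegral_congr_fun hA fun x hx => ?_
  have := ht hx
  rw [mem_Ici] at this
  rw [hatCdf₂_eq_one hρ hσ (by linarith), hatCdf₂_eq_one hρ hρ (by linarith)]

/-- The repulsion of two sets on different sides of a jump is compensated, up to `halfMeanAbs`, by
the terms that are linear in the set on the left. -/
lemma interaction_le_of_separated (hσ : 0 < σ) (h : σ ≤ ρ) (hA : MeasurableSet A)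
    (hvA : volume A < ∞) (hB : MeasurableSet B) (hvB : volume B < ∞) (hAt : A ⊆ Iic t)
    (hBt : B ⊆ Ioi t) :
    interaction ρ A B ≤
      stepInteraction ρ ρ A t - stepInteraction ρ σ A t + halfMeanAbs ρ σ := by
  have hρ := hσ.trans_le h
  have h1 : interaction ρ A B ≤ stepInteraction ρ ρ A t := by
    have hi := integrable_conv_ind hρ hA hvA
    refine integral_mono (integrable_mul_top hi (memLp_top_conv_ind hρ hB hvB))
      (integrable_mul_top hi (memLp_top_hatCdf hρ t)) fun x => ?_
    refine mul_le_mul_of_nonneg_left ?_ (conv_ind_nonneg hρ A x)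
    rw [← conv_hatKernel_step hρ]
    exact conv_mono (integrable_hatKernel hρ) (hatKernel_nonneg hρ) (memLp_top_ind hB)
      (memLp_top_step t) (indicator_le_indicator_of_subset hBt fun _ => zero_le_one) x
  have h2 := setIntegral_hatCdf₂_le hσ h hAt
  rw [← stepInteraction_eq hρ hσ hA hvA] at h2
  linarith

lemma conv_ind_eq_zero_of_le {p x : ℝ} (hA : A ⊆ Iic p) (hx : p + ρ ≤ x) :
    conv (hatKernel ρ) (ind A) x = 0 := by
  rw [conv_apply, ← integral_zero ℝ ℝ (μ := volume)]
  congr 1; ext y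
  by_cases hy : x - y ∈ A
  · have := hA hy
    rw [mem_Iic] at this
    rw [hatKernel_eq_zero (le_trans (by linarith) (le_abs_self y)), zero_mul]
  · rw [ind, indicator_of_notMem hy, mul_zero]

lemma conv_ind_eq_zero_of_ge {p x : ℝ} (hA : A ⊆ Ici p) (hx : x ≤ p - ρ) :
    conv (hatKernel ρ) (ind A) x = 0 := by
  rw [conv_apply, ← integral_zero ℝ ℝ (μ := volume)]
  congr 1; ext y
  by_cases hy : x - y ∈ A
  · have := hA hy
    rw [mem_Ici] at this
    rw [hatKernel_eq_zero (le_trans (by linarith) (neg_le_abs y)), zero_mul]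
  · rw [ind, indicator_of_notMem hy, mul_zero]

lemma interaction_eq_zero {p q : ℝ} (hA : A ⊆ Iic p) (hB : B ⊆ Ici q)
    (hpq : p + 2 * ρ ≤ q) : interaction ρ A B = 0 := by
  rw [interaction, ← integral_zero ℝ ℝ (μ := volume)]
  congr 1; ext x
  rcases le_total (p + ρ) x with hx | hx
  · rw [conv_ind_eq_zero_of_le hA hx, zero_mul]
  · rw [conv_ind_eq_zero_of_ge hB (by linarith), mul_zero]

/-- The interior of an interval sees the constant `1`; each end point loses at most
`halfMeanAbs ρ ρ`. -/
lemma le_interaction_self (hρ : 0 < ρ) {p q : ℝ} (hpq : p ≤ q) :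
    q - p - 2 * halfMeanAbs ρ ρ ≤ interaction ρ (Ioo p q) (Ioo p q) := by
  have hA : MeasurableSet (Ioo p q) := measurableSet_Ioo
  have hv : volume (Ioo p q) < ∞ := by rw [Real.volume_Ioo]; exact ENNReal.ofReal_lt_top
  have hc : ∀ x, conv (hatKernel ρ) (ind (Ioo p q)) x = hatCdf ρ (x - p) - hatCdf ρ (x - q) := by
    intro x
    have e : ind (Ioo p q) =ᵐ[volume] fun y => step p y - step q y := by
      have : ∀ᵐ y : ℝ, y ≠ q := (Measure.ae_ne volume q)
      filter_upwards [this] with y hy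
      simp only [ind, step, indicator_apply, mem_Ioo, mem_Ioi]
      rcases lt_or_gt_of_ne hy with hy | hy
      · simp [hy, not_lt.2 hy.le]
      · simp [hy, not_lt.2 hy.le, hpq.trans_lt hy]
    rw [conv_congr_right _ e, conv_sub (integrable_hatKernel hρ) (memLp_top_step p)
      (memLp_top_step q), conv_hatKernel_step hρ, conv_hatKernel_step hρ]
  have hi := integrable_conv_ind hρ hA hv
  have h1 : interaction ρ (Ioo p q) (Ioo p q) =
      stepInteraction ρ ρ (Ioo p q) p - stepInteraction ρ ρ (Ioo p q) q := by
    rw [interaction, stepInteraction, stepInteraction,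
      ← integral_sub (integrable_mul_top hi (memLp_top_hatCdf hρ p))
        (integrable_mul_top hi (memLp_top_hatCdf hρ q))]
    congr 1; ext x
    rw [hc x]; ring
  have h2 := setIntegral_hatCdf₂_le hρ le_rfl (A := Ioo p q) (t := q) fun x hx => hx.2.le
  have h3 := setIntegral_hatCdf₂_neg_le hρ le_rfl hA (t := p) fun x hx => hx.1.le
  have h4 : ∫ x in Ioo p q, hatCdf₂ ρ ρ (p - x) = q - p - ∫ x in Ioo p q, hatCdf₂ ρ ρ (x - p) := by
    have e : ∫ x in Ioo p q, hatCdf₂ ρ ρ (p - x) = ∫ x in Ioo p q, (1 - hatCdf₂ ρ ρ (x - p)) := by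
      congr 1; ext x
      have := hatCdf₂_add_neg hρ hρ (x - p)
      rw [neg_sub] at this; linarith
    rw [e, integral_sub (integrableOn_const (C := (1 : ℝ)) hv.ne).integrable (integrableOn_hatCdf₂_sub hρ hρ hA hv p)]
    simp [hpq]
  rw [h1, stepInteraction_eq hρ hρ hA hv, stepInteraction_eq hρ hρ hA hv]
  linarith

end Pairings

/-! ### Profiles with alternating signs -/

/-- The sum of the entries of a tridiagonal symmetric matrix. -/
lemma sum_tridiagonal (c : ℕ → ℕ → ℝ) (hs : ∀ k l, c k l = c l k) (N : ℕ)
    (h0 : ∀ k l, k + 2 ≤ l → l ≤ N → c k l = 0) :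
    ∑ k ∈ Finset.range (N + 1), ∑ l ∈ Finset.range (N + 1), c k l =
      ∑ k ∈ Finset.range (N + 1), c k k + 2 * ∑ j ∈ Finset.range N, c j (j + 1) := by
  induction N with
  | zero => simp
  | succ N ih =>
    have ih' := ih fun k l hkl hl => h0 k l hkl (by omega)
    have hcol : ∑ k ∈ Finset.range (N + 1), c k (N + 1) = c N (N + 1) := by
      rw [Finset.sum_range_succ, Finset.sum_eq_zero, zero_add]
      intro k hk
      exact h0 k (N + 1) (by have := Finset.mem_range.1 hk; omega) le_rfl
    have hrow : ∑ l ∈ Finset.range (N + 1), c (N + 1) l = c N (N + 1) := by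
      rw [← hcol]; exact Finset.sum_congr rfl fun l _ => hs _ _
    rw [Finset.sum_range_succ]
    simp only [Finset.sum_range_succ (fun l => c _ l) (N + 1)]
    rw [Finset.sum_add_distrib, ih', hcol, hrow,
      Finset.sum_range_succ (fun j => c j (j + 1)) N]
    ring

/-- Jumps at `τ 1, …, τ N`, together with two end points `τ 0`, `τ (N + 1)` of the window
considered, such that consecutive points are at least `ω` apart. -/
def Separated (ω : ℝ) (N : ℕ) (τ : ℕ → ℝ) : Prop := ∀ k ≤ N, τ k + ω ≤ τ (k + 1)

lemma Separated.le {ω : ℝ} {N : ℕ} {τ : ℕ → ℝ} (h : Separated ω N τ) (hω : 0 ≤ ω) {k l : ℕ}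
    (hkl : k ≤ l) (hl : l ≤ N + 1) : τ k ≤ τ l := by
  induction l, hkl using Nat.le_induction with
  | base => exact le_rfl
  | succ l _ ih => linarith [ih (by omega), h l (by omega)]

/-- The bar code that starts with the value `0` and switches at `τ 1, …, τ N`. -/
noncomputable def profile (N : ℕ) (τ : ℕ → ℝ) (x : ℝ) : ℝ :=
  ∑ j ∈ Finset.range N, (-1) ^ j * step (τ (j + 1)) x

/-- The function equal to `(-1) ^ k` on `A k`, for `k ≤ N`. -/
noncomputable def alternating (N : ℕ) (A : ℕ → Set ℝ) (x : ℝ) : ℝ :=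
  ∑ k ∈ Finset.range (N + 1), (-1) ^ k * ind (A k) x

/-- The sets `A k` are measurable and lie in the respective intervals `(τ k, τ (k + 1))`. -/
def Fits (N : ℕ) (τ : ℕ → ℝ) (A : ℕ → Set ℝ) : Prop :=
  ∀ k ≤ N, MeasurableSet (A k) ∧ A k ⊆ Ioo (τ k) (τ (k + 1))

section Energy

variable {ρ σ ω : ℝ} {N : ℕ} {τ : ℕ → ℝ} {A : ℕ → Set ℝ}

lemma Fits.volume_lt_top (hA : Fits N τ A) {k : ℕ} (hk : k ≤ N) : volume (A k) < ∞ :=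
  (measure_mono (hA k hk).2).trans_lt (by rw [Real.volume_Ioo]; exact ENNReal.ofReal_lt_top)

lemma Fits.integrable_alternating (hA : Fits N τ A) : Integrable (alternating N A) volume := by
  refine integrable_finsetSum _ fun k hk => ?_
  have hk : k ≤ N := by have := Finset.mem_range.1 hk; omega
  exact (integrable_ind (hA k hk).1 (hA.volume_lt_top hk)).const_mul _

lemma Fits.memLp_top_alternating (hA : Fits N τ A) : MemLp (alternating N A) ∞ volume := by
  refine memLp_finsetSum _ fun k hk => ?_
  have hk : k ≤ N := by have := Finset.mem_range.1 hk; omega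
  exact (memLp_top_ind (hA k hk).1).const_mul _

lemma memLp_top_profile (N : ℕ) (τ : ℕ → ℝ) : MemLp (profile N τ) ∞ volume :=
  memLp_finsetSum _ fun j _ => (memLp_top_step (τ (j + 1))).const_mul _

lemma conv_profile (hσ : 0 < σ) (N : ℕ) (τ : ℕ → ℝ) (x : ℝ) :
    conv (hatKernel σ) (profile N τ) x =
      ∑ j ∈ Finset.range N, (-1) ^ j * hatCdf σ (x - τ (j + 1)) := by
  have := conv_sum (integrable_hatKernel hσ) (Finset.range N)
    (fun j y => (-1) ^ j * step (τ (j + 1)) y)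
    (fun j _ => (memLp_top_step (τ (j + 1))).const_mul _) x
  refine this.trans (Finset.sum_congr rfl fun j _ => ?_)
  rw [conv_const_mul, conv_hatKernel_step hσ]

lemma Fits.conv_alternating (hρ : 0 < ρ) (hA : Fits N τ A) (x : ℝ) :
    conv (hatKernel ρ) (alternating N A) x =
      ∑ k ∈ Finset.range (N + 1), (-1) ^ k * conv (hatKernel ρ) (ind (A k)) x := by
  have := conv_sum (integrable_hatKernel hρ) (Finset.range (N + 1))
    (fun k y => (-1) ^ k * ind (A k) y) (fun k hk => by
      have hk : k ≤ N := by have := Finset.mem_range.1 hk; omega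
      exact (memLp_top_ind (hA k hk).1).const_mul _) x
  refine this.trans (Finset.sum_congr rfl fun k _ => ?_)
  rw [conv_const_mul]

lemma neg_one_pow_mul_self (k : ℕ) : (-1 : ℝ) ^ k * (-1) ^ k = 1 := by
  rw [← mul_pow]; simp

/-- The quadratic part of the energy: only sets in equal or adjacent intervals interact. -/
lemma Fits.integral_conv_alternating_sq (hρ : 0 < ρ) (hω : 2 * ρ ≤ ω) (hτ : Separated ω N τ)
    (hA : Fits N τ A) :
    ∫ x, conv (hatKernel ρ) (alternating N A) x * conv (hatKernel ρ) (alternating N A) x =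
      ∑ k ∈ Finset.range (N + 1), interaction ρ (A k) (A k)
        - 2 * ∑ j ∈ Finset.range N, interaction ρ (A j) (A (j + 1)) := by
  have hle : ∀ k ∈ Finset.range (N + 1), k ≤ N := fun k hk => by
    have := Finset.mem_range.1 hk; omega
  have h1 : ∫ x, conv (hatKernel ρ) (alternating N A) x * conv (hatKernel ρ) (alternating N A) x =
      ∑ k ∈ Finset.range (N + 1), ∑ l ∈ Finset.range (N + 1),
        (-1) ^ k * (-1) ^ l * interaction ρ (A k) (A l) := by
    have hint : ∀ k ∈ Finset.range (N + 1), ∀ l ∈ Finset.range (N + 1), Integrable (fun x =>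
        (-1 : ℝ) ^ k * (-1) ^ l * (conv (hatKernel ρ) (ind (A k)) x *
          conv (hatKernel ρ) (ind (A l)) x)) volume := fun k hk l hl =>
      (integrable_mul_top (integrable_conv_ind hρ (hA k (hle k hk)).1 (hA.volume_lt_top (hle k hk)))
        (memLp_top_conv_ind hρ (hA l (hle l hl)).1 (hA.volume_lt_top (hle l hl)))).const_mul _
    calc _ = ∫ x, ∑ k ∈ Finset.range (N + 1), ∑ l ∈ Finset.range (N + 1),
          (-1 : ℝ) ^ k * (-1) ^ l * (conv (hatKernel ρ) (ind (A k)) x *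
            conv (hatKernel ρ) (ind (A l)) x) := by
          congr 1; ext x
          rw [hA.conv_alternating hρ, Finset.sum_mul_sum]
          refine Finset.sum_congr rfl fun k _ => Finset.sum_congr rfl fun l _ => ?_
          ring
      _ = _ := by
          rw [integral_finsetSum _ fun k hk => integrable_finsetSum _ (hint k hk)]
          refine Finset.sum_congr rfl fun k hk => ?_
          rw [integral_finsetSum _ (hint k hk)]
          refine Finset.sum_congr rfl fun l _ => ?_
          rw [integral_const_mul, interaction]
  rw [h1, sum_tridiagonal]
  · rw [sub_eq_add_neg, ← mul_neg, ← Finset.sum_neg_distrib]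
    congr 1
    · refine Finset.sum_congr rfl fun k _ => ?_
      rw [neg_one_pow_mul_self, one_mul]
    · congr 1
      refine Finset.sum_congr rfl fun j _ => ?_
      rw [pow_succ, ← mul_assoc, neg_one_pow_mul_self]; ring
  · intro k l
    rw [interaction_comm]; ring
  · intro k l hkl hl
    have h2 : interaction ρ (A k) (A l) = 0 := by
      refine interaction_eq_zero (p := τ (k + 1)) (q := τ l) (fun x hx => ?_) (fun x hx => ?_) ?_
      · exact ((hA k (by omega)).2 hx).2.le
      · exact ((hA l hl).2 hx).1.le
      · have := hτ (k + 1) (by omega)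
        have h3 := hτ.le (by linarith) (show k + 1 + 1 ≤ l by omega) (by omega)
        linarith
    rw [h2, mul_zero]

/-- The difference of the interactions with a step of the hat kernels of sizes `ρ` and `σ`. -/
noncomputable def stepGain (ρ σ : ℝ) (A : Set ℝ) (t : ℝ) : ℝ :=
  stepInteraction ρ ρ A t - stepInteraction ρ σ A t

/-- The part of the energy that is linear in the perturbation: each jump only sees the two
adjacent intervals. -/
lemma Fits.integral_conv_alternating_mul_profile (hσ : 0 < σ) (h : σ ≤ ρ) (hω : 2 * ρ ≤ ω)
    (hτ : Separated ω N τ) (hA : Fits N τ A) :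
    ∫ x, conv (hatKernel ρ) (alternating N A) x *
        (conv (hatKernel ρ) (profile N τ) x - conv (hatKernel σ) (profile N τ) x) =
      ∑ j ∈ Finset.range N,
        (stepGain ρ σ (A j) (τ (j + 1)) - stepGain ρ σ (A (j + 1)) (τ (j + 1))) := by
  have hρ := hσ.trans_le h
  have hle : ∀ k ∈ Finset.range (N + 1), k ≤ N := fun k hk => by
    have := Finset.mem_range.1 hk; omega
  have hi : ∀ k ∈ Finset.range (N + 1), ∀ (s : ℝ) (_ : 0 < s) (t : ℝ), Integrable (fun x =>
      conv (hatKernel ρ) (ind (A k)) x * hatCdf s (x - t)) volume := fun k hk s hs t =>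
    integrable_mul_top (integrable_conv_ind hρ (hA k (hle k hk)).1 (hA.volume_lt_top (hle k hk)))
      (memLp_top_hatCdf hs t)
  have hint : ∀ j ∈ Finset.range N, ∀ k ∈ Finset.range (N + 1), Integrable (fun x =>
      (-1 : ℝ) ^ j * (-1) ^ k * (conv (hatKernel ρ) (ind (A k)) x * hatCdf ρ (x - τ (j + 1)) -
        conv (hatKernel ρ) (ind (A k)) x * hatCdf σ (x - τ (j + 1)))) volume :=
    fun j _ k hk => ((hi k hk ρ hρ _).sub (hi k hk σ hσ _)).const_mul _
  calc _ = ∫ x, ∑ j ∈ Finset.range N, ∑ k ∈ Finset.range (N + 1), (-1 : ℝ) ^ j * (-1) ^ k *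
        (conv (hatKernel ρ) (ind (A k)) x * hatCdf ρ (x - τ (j + 1)) -
          conv (hatKernel ρ) (ind (A k)) x * hatCdf σ (x - τ (j + 1))) := by
        congr 1; ext x
        rw [hA.conv_alternating hρ, conv_profile hρ, conv_profile hσ, ← Finset.sum_sub_distrib,
          mul_comm, Finset.sum_mul_sum]
        refine Finset.sum_congr rfl fun k _ => Finset.sum_congr rfl fun l _ => ?_
        ring
    _ = ∑ j ∈ Finset.range N, ∑ k ∈ Finset.range (N + 1), (-1 : ℝ) ^ j * (-1) ^ k *
          stepGain ρ σ (A k) (τ (j + 1)) := by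
        rw [integral_finsetSum _ fun j hj => integrable_finsetSum _ (hint j hj)]
        refine Finset.sum_congr rfl fun j hj => ?_
        rw [integral_finsetSum _ (hint j hj)]
        refine Finset.sum_congr rfl fun k hk => ?_
        rw [integral_const_mul, integral_sub (hi k hk ρ hρ _) (hi k hk σ hσ _)]
        rfl
    _ = _ := by
        refine Finset.sum_congr rfl fun j hj => ?_
        have hj := Finset.mem_range.1 hj
        rw [Finset.sum_eq_add_of_mem j (j + 1) (Finset.mem_range.2 (by omega))
          (Finset.mem_range.2 (by omega)) (by omega), pow_succ, neg_one_pow_mul_self, ← mul_assoc,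
          neg_one_pow_mul_self]
        · ring
        · rintro k hk ⟨hk1, hk2⟩
          have hk := hle k hk
          have hgain : stepGain ρ σ (A k) (τ (j + 1)) = 0 := by
            rw [stepGain, sub_eq_zero]
            rcases lt_or_ge k j with hkj | hkj
            · refine stepInteraction_eq_of_le hσ h (hA k hk).1 (hA.volume_lt_top hk)
                fun x hx => ?_
              have h1 := ((hA k hk).2 hx).2
              have h2 := hτ.le (by linarith) (show k + 1 ≤ j by omega) (by omega)
              have h3 := hτ j (by omega)
              rw [mem_Iic]; linarith
            · refine stepInteraction_eq_of_ge hσ h (hA k hk).1 (hA.volume_lt_top hk)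
                fun x hx => ?_
              have h1 := ((hA k hk).2 hx).1
              have h2 := hτ.le (by linarith) (show j + 1 + 1 ≤ k by omega) (by omega)
              have h3 := hτ (j + 1) (by omega)
              rw [mem_Ici]; linarith
          rw [hgain, mul_zero]

/-- The data term of `profile + alternating` exceeds that of `profile` by at least a fixed amount
for each interval that is filled completely, up to the nonnegative quadratic energy of the other
intervals. -/
lemma Fits.energy_lower_bound (hσ : 0 < σ) (h : σ ≤ ρ) (hω : 2 * ρ ≤ ω) (hτ : Separated ω N τ)
    (hA : Fits N τ A) (M : Finset ℕ) (hM : M ⊆ Finset.range (N + 1))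
    (hfull : ∀ k ∈ M, A k = Ioo (τ k) (τ (k + 1))) :
    (M.card : ℝ) * (ω - 2 * halfMeanAbs ρ ρ - 4 * halfMeanAbs ρ σ) +
      (∫ x, conv (hatKernel ρ) (alternating N fun k => if k ∈ M then ∅ else A k) x *
        conv (hatKernel ρ) (alternating N fun k => if k ∈ M then ∅ else A k) x) ≤
    (∫ x, conv (hatKernel ρ) (alternating N A) x * conv (hatKernel ρ) (alternating N A) x) +
      2 * ∫ x, conv (hatKernel ρ) (alternating N A) x *
        (conv (hatKernel ρ) (profile N τ) x - conv (hatKernel σ) (profile N τ) x) := by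
  have hρ := hσ.trans_le h
  have he := halfMeanAbs_nonneg hσ h
  have hA' : Fits N τ fun k => if k ∈ M then ∅ else A k := by
    intro k hk
    simp only
    split_ifs
    · exact ⟨MeasurableSet.empty, empty_subset _⟩
    · exact hA k hk
  rw [hA.integral_conv_alternating_sq hρ hω hτ, hA'.integral_conv_alternating_sq hρ hω hτ,
    hA.integral_conv_alternating_mul_profile hσ h hω hτ]
  have h0 : ∀ B, interaction ρ ∅ B = 0 := fun B => by simp [interaction, ind, conv_apply]
  have h0' : ∀ B, interaction ρ B ∅ = 0 := fun B => by rw [interaction_comm, h0]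
  have hind : ∀ k, (0 : ℝ) ≤ if k ∈ M then 1 else 0 := fun k => by split_ifs <;> norm_num
  have hcard : ∑ k ∈ Finset.range (N + 1), (if k ∈ M then (1 : ℝ) else 0) = M.card := by
    rw [Finset.sum_ite_mem, Finset.inter_eq_right.2 hM]; simp
  have hcard1 : ∑ j ∈ Finset.range N, (if j ∈ M then (1 : ℝ) else 0) ≤ M.card := by
    rw [← hcard, Finset.sum_range_succ]; linarith [hind N]
  have hcard2 : ∑ j ∈ Finset.range N, (if j + 1 ∈ M then (1 : ℝ) else 0) ≤ M.card := by
    rw [← hcard, Finset.sum_range_succ']; linarith [hind 0]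
  have hdiag : ∑ k ∈ Finset.range (N + 1), ((if k ∈ M then (1 : ℝ) else 0) *
        (ω - 2 * halfMeanAbs ρ ρ) +
        interaction ρ (if k ∈ M then ∅ else A k) (if k ∈ M then ∅ else A k)) ≤
      ∑ k ∈ Finset.range (N + 1), interaction ρ (A k) (A k) := by
    refine Finset.sum_le_sum fun k hk => ?_
    have hk : k ≤ N := by have := Finset.mem_range.1 hk; omega
    split_ifs with hkM
    · rw [h0, hfull k hkM]
      have h1 := hτ k hk
      have h2 := le_interaction_self hρ (p := τ k) (q := τ (k + 1)) (by linarith)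
      linarith
    · linarith
  have hjump : ∑ j ∈ Finset.range N, (-2 * halfMeanAbs ρ σ * (if j ∈ M then (1 : ℝ) else 0) +
        -2 * halfMeanAbs ρ σ * (if j + 1 ∈ M then (1 : ℝ) else 0) +
        -2 * interaction ρ (if j ∈ M then ∅ else A j) (if j + 1 ∈ M then ∅ else A (j + 1))) ≤
      ∑ j ∈ Finset.range N, (-2 * interaction ρ (A j) (A (j + 1)) +
        2 * (stepGain ρ σ (A j) (τ (j + 1)) - stepGain ρ σ (A (j + 1)) (τ (j + 1)))) := by
    refine Finset.sum_le_sum fun j hj => ?_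
    have hj := Finset.mem_range.1 hj
    have hj0 : j ≤ N := by omega
    have hl : A j ⊆ Iic (τ (j + 1)) := fun x hx => ((hA j hj0).2 hx).2.le
    have hr : A (j + 1) ⊆ Ioi (τ (j + 1)) := fun x hx => ((hA (j + 1) hj).2 hx).1
    have g1 := stepInteraction_le_of_subset_Iic hσ h (hA j hj0).1 (hA.volume_lt_top hj0) hl
    have g2 := stepInteraction_le_of_subset_Ici hσ h (hA (j + 1) hj).1 (hA.volume_lt_top hj)
      (hr.trans Ioi_subset_Ici_self)
    have g3 := interaction_le_of_separated hσ h (hA j hj0).1 (hA.volume_lt_top hj0)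
      (hA (j + 1) hj).1 (hA.volume_lt_top hj) hl hr
    simp only [stepGain]
    split_ifs <;> (try simp only [h0, h0']) <;> linarith
  simp only [Finset.sum_add_distrib, ← Finset.sum_mul, ← Finset.mul_sum] at hdiag hjump
  rw [hcard] at hdiag
  have m1 := mul_le_mul_of_nonneg_left hcard1 he
  have m2 := mul_le_mul_of_nonneg_left hcard2 he
  linarith

end Energy

/-! ### Pointwise values of profiles -/

section Values

variable {ρ ω : ℝ} {N : ℕ} {τ : ℕ → ℝ} {A : ℕ → Set ℝ}

lemma sum_neg_one_pow_of_lt (m N : ℕ) (h : m ≤ N) :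
    ∑ j ∈ Finset.range N, (-1 : ℝ) ^ j * (if j < m then 1 else 0) = (1 - (-1) ^ m) / 2 := by
  induction N, h using Nat.le_induction with
  | base =>
    rw [Finset.sum_congr rfl (g := fun j => (-1 : ℝ) ^ j) fun j hj => by
      rw [if_pos (Finset.mem_range.1 hj), mul_one]]
    rw [geom_sum_eq (by norm_num)]
    ring
  | succ N h ih =>
    rw [Finset.sum_range_succ, ih, if_neg (by omega), mul_zero, add_zero]

lemma profile_apply_of_lt {x : ℝ} {m : ℕ} (hm : m ≤ N) (h1 : ∀ j < m, τ (j + 1) < x)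
    (h2 : ∀ j, m ≤ j → j < N → x ≤ τ (j + 1)) : profile N τ x = (1 - (-1) ^ m) / 2 := by
  rw [profile, ← sum_neg_one_pow_of_lt m N hm]
  refine Finset.sum_congr rfl fun j hj => ?_
  congr 1
  rw [step]
  split_ifs with hjm
  · exact indicator_of_mem (mem_Ioi.2 (h1 j hjm)) _
  · exact indicator_of_notMem (not_lt.2 (h2 j (not_lt.1 hjm) (Finset.mem_range.1 hj))) _

lemma Separated.profile_apply (hτ : Separated ω N τ) (hω : 0 ≤ ω) {k : ℕ} (hk : k ≤ N) {x : ℝ}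
    (hx : x ∈ Ioo (τ k) (τ (k + 1))) : profile N τ x = (1 - (-1) ^ k) / 2 := by
  refine profile_apply_of_lt hk (fun j hj => ?_) fun j hj hjN => ?_
  · exact (hτ.le hω (by omega) (by omega)).trans_lt hx.1
  · exact hx.2.le.trans (hτ.le hω (by omega) (by omega))

lemma Fits.notMem_of_ne (hτ : Separated ω N τ) (hω : 0 ≤ ω) (hA : Fits N τ A) {k l : ℕ}
    (hk : k ≤ N) (hl : l ≤ N) (hlk : l ≠ k) {x : ℝ} (hx : x ∈ Ioo (τ k) (τ (k + 1))) :
    x ∉ A l := by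
  intro hxl
  have h := (hA l hl).2 hxl
  rcases lt_or_gt_of_ne hlk with h1 | h1
  · have := hτ.le hω (show l + 1 ≤ k by omega) (by omega)
    linarith [h.2, hx.1]
  · have := hτ.le hω (show k + 1 ≤ l by omega) (by omega)
    linarith [h.1, hx.2]

lemma Fits.alternating_apply (hτ : Separated ω N τ) (hω : 0 ≤ ω) (hA : Fits N τ A) {k : ℕ}
    (hk : k ≤ N) {x : ℝ} (hx : x ∈ Ioo (τ k) (τ (k + 1))) :
    alternating N A x = (-1) ^ k * ind (A k) x := by
  rw [alternating, Finset.sum_eq_single_of_mem k (Finset.mem_range.2 (by omega))]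
  intro l hl hlk
  have hl : l ≤ N := by have := Finset.mem_range.1 hl; omega
  rw [ind, indicator_of_notMem (hA.notMem_of_ne hτ hω hk hl hlk hx), mul_zero]

lemma exists_mem_Ioo_of_lt {s : ℕ → ℝ} {n : ℕ} {x : ℝ} (hne : ∀ k, x ≠ s k) (h0 : s 0 < x)
    (hn : x < s n) : ∃ k < n, x ∈ Ioo (s k) (s (k + 1)) := by
  induction n with
  | zero => exact absurd h0 (not_lt.2 hn.le)
  | succ n ih =>
    rcases lt_or_gt_of_ne (hne n) with h | h
    · obtain ⟨k, hk, hxk⟩ := ih h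
      exact ⟨k, by omega, hxk⟩
    · exact ⟨n, by omega, h, hn⟩

/-! ### Total variation of profiles -/

lemma totalVariation_profile_le (N : ℕ) (τ : ℕ → ℝ) : totalVariation (profile N τ) ≤ N := by
  refine iSup₂_le ?_
  rintro g ⟨hg, hc, hg1⟩
  have hi : Integrable (deriv g) volume :=
    (hg.continuous_deriv le_rfl).integrable_of_hasCompactSupport hc.deriv
  have h1 : ∀ t, ∫ x, step t x * deriv g x = -g t := by
    intro t
    rw [← hc.integral_Ioi_deriv_eq hg t, ← integral_indicator measurableSet_Ioi]
    congr 1; ext x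
    by_cases hx : t < x <;> simp [step, hx]
  have hint : ∀ j ∈ Finset.range N, Integrable (fun x => (-1 : ℝ) ^ j *
      (step (τ (j + 1)) x * deriv g x)) volume := fun j _ =>
    (hi.mul_of_top_right (memLp_top_step (τ (j + 1)))).const_mul _
  have h2 : ∫ x, profile N τ x * deriv g x = ∑ j ∈ Finset.range N, (-1) ^ j * -g (τ (j + 1)) := by
    simp only [profile, Finset.sum_mul, mul_assoc]
    rw [integral_finsetSum _ hint]
    refine Finset.sum_congr rfl fun j _ => ?_
    rw [integral_const_mul, h1]
  rw [h2, ← ENNReal.ofReal_natCast]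
  refine ENNReal.ofReal_le_ofReal ?_
  calc ∑ j ∈ Finset.range N, (-1) ^ j * -g (τ (j + 1)) ≤ ∑ _j ∈ Finset.range N, (1 : ℝ) := by
        refine Finset.sum_le_sum fun j _ => (le_abs_self _).trans ?_
        rw [abs_mul, abs_pow, abs_neg, abs_neg, abs_one, one_pow, one_mul]
        exact hg1 _
    _ = N := by simp

/-- A function that agrees with the profile somewhere in all but `M.card` of the intervals has
lost at most two jumps for each exceptional interval. -/
lemma Fits.le_totalVariation_add (hω : 0 < ω) (hτ : Separated ω N τ) (hA : Fits N τ A)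
    (M : Finset ℕ) (hM : M ⊆ Finset.range (N + 1))
    (hmiss : ∀ k ≤ N, k ∉ M → volume (Ioo (τ k) (τ (k + 1)) \ A k) ≠ 0) {u : ℝ → ℝ}
    (hu : Integrable u volume)
    (hue : u =ᵐ[volume] fun x => profile N τ x + alternating N A x) :
    (N : ℝ≥0∞) ≤ totalVariation u + 2 * M.card := by
  obtain ⟨S, hS, hvar⟩ := exists_eVariationOn_le hu
  have hgood : ∀ᵐ x, x ∈ S ∧ u x = profile N τ x + alternating N A x := by
    filter_upwards [hS, hue] with x h1 h2 using ⟨h1, h2⟩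
  have hex : ∀ k ≤ N, ∃ x ∈ Ioo (τ k) (τ (k + 1)),
      (x ∈ S ∧ u x = profile N τ x + alternating N A x) ∧ (k ∉ M → x ∉ A k) := by
    intro k hk
    have hpos : volume (if k ∈ M then Ioo (τ k) (τ (k + 1)) else Ioo (τ k) (τ (k + 1)) \ A k) ≠ 0 := by
      split_ifs with h
      · rw [Real.volume_Ioo]
        have := hτ k hk
        simp only [ne_eq, ENNReal.ofReal_eq_zero, not_le]
        linarith
      · exact hmiss k hk h
    have hfr := frequently_ae_mem_iff.2 hpos
    obtain ⟨x, hx1, hx2⟩ := (hfr.and_eventually hgood).exists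
    split_ifs at hx1 with h
    · exact ⟨x, hx1, hx2, fun h' => absurd h h'⟩
    · exact ⟨x, hx1.1, hx2, fun _ => hx1.2⟩
  choose! x hx1 hx2 hx3 using hex
  have hmono : Monotone fun k => x (min k N) := by
    refine monotone_nat_of_le_succ fun k => ?_
    rcases lt_or_ge k N with h | h
    · rw [min_eq_left h.le, min_eq_left (by omega : k + 1 ≤ N)]
      exact ((hx1 k h.le).2.trans (hx1 (k + 1) h).1).le
    · rw [min_eq_right h, min_eq_right (by omega)]
  have hsum := eVariationOn.sum_le (f := u) (s := S) (n := N) (u := fun k => x (min k N)) hmono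
    fun k => (hx2 _ (min_le_right k N)).1
  have hval : ∀ k ≤ N, k ∉ M → u (x k) = (1 - (-1) ^ k) / 2 := by
    intro k hk hkM
    rw [(hx2 k hk).2, hτ.profile_apply hω.le hk (hx1 k hk),
      hA.alternating_apply hτ hω.le hk (hx1 k hk), ind, indicator_of_notMem (hx3 k hk hkM), mul_zero,
      add_zero]
  have hedge : ∀ k ∈ Finset.range N, (1 : ℝ≥0∞) ≤
      edist (u (x (min (k + 1) N))) (u (x (min k N))) +
        ((if k ∈ M then 1 else 0) + if k + 1 ∈ M then 1 else 0) := by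
    intro k hk
    have hk := Finset.mem_range.1 hk
    rw [min_eq_left hk.le, min_eq_left (by omega : k + 1 ≤ N)]
    by_cases h1 : k ∈ M
    · rw [if_pos h1]; exact le_add_left (le_add_right le_rfl)
    by_cases h2 : k + 1 ∈ M
    · rw [if_pos h2]; exact le_add_left (le_add_left le_rfl)
    rw [hval k hk.le h1, hval (k + 1) hk h2, edist_dist, Real.dist_eq, pow_succ,
      show (1 - (-1 : ℝ) ^ k * -1) / 2 - (1 - (-1) ^ k) / 2 = (-1) ^ k by ring, abs_pow, abs_neg,
      abs_one, one_pow, ENNReal.ofReal_one]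
    exact le_self_add
  have hcard : ∑ k ∈ Finset.range (N + 1), (if k ∈ M then (1 : ℝ≥0∞) else 0) = M.card := by
    rw [Finset.sum_ite_mem, Finset.inter_eq_right.2 hM]; simp
  calc (N : ℝ≥0∞) = ∑ _k ∈ Finset.range N, (1 : ℝ≥0∞) := by simp
    _ ≤ ∑ k ∈ Finset.range N, (edist (u (x (min (k + 1) N))) (u (x (min k N))) +
        ((if k ∈ M then 1 else 0) + if k + 1 ∈ M then 1 else 0)) := Finset.sum_le_sum hedge
    _ ≤ totalVariation u + (M.card + M.card) := by
        rw [Finset.sum_add_distrib, Finset.sum_add_distrib]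
        gcongr
        · exact hsum.trans hvar
        · rw [← hcard, Finset.sum_range_succ]; exact le_self_add
        · rw [← hcard, Finset.sum_range_succ']; exact le_self_add
    _ = _ := by rw [two_mul]

/-! ### Injectivity -/

lemma hatCdf_pos (hρ : 0 < ρ) {x : ℝ} (hx : -ρ < x) : 0 < hatCdf ρ x := by
  rcases le_total x 0 with h | h
  · rw [hatCdf_of_nonpos hρ h, max_eq_left (by linarith)]
    have : 0 < x + ρ := by linarith
    positivity
  · linarith [hatCdf_add_neg hρ x, monotone_hatCdf hρ (by linarith : -x ≤ x)]

/-- Convolution with the hat kernel is injective on functions whose sign alternates between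
consecutive intervals: testing against the smoothed indicator of `(-∞, τ (k + 1) - ρ)`, which lives
on `(-∞, τ (k + 1))`, removes the sets `A k` one after the other. -/
lemma Fits.volume_eq_zero_of_conv (hρ : 0 < ρ) (hω : 0 ≤ ω) (hτ : Separated ω N τ)
    (hA : Fits N τ A) (h : ∀ᵐ x, conv (hatKernel ρ) (alternating N A) x = 0) :
    ∀ k ≤ N, volume (A k) = 0 := by
  intro k
  induction k using Nat.strong_induction_on with
  | _ k ih =>
  intro hk
  set c := τ (k + 1) - ρ with hc
  have hg : MemLp (fun x => 1 - step c x) ∞ volume := (memLp_top_const 1).sub (memLp_top_step c)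
  have hconv : ∀ x, conv (hatKernel ρ) (fun y => 1 - step c y) x = hatCdf ρ (c - x) := by
    intro x
    rw [conv_sub (integrable_hatKernel hρ) (memLp_top_const 1) (memLp_top_step c),
      conv_hatKernel_const hρ, conv_hatKernel_step hρ]
    have := hatCdf_add_neg hρ (x - c)
    rw [neg_sub] at this
    linarith
  have hm : MemLp (fun x => hatCdf ρ (c - x)) ∞ volume := by
    have := (memLp_top_const (1 : ℝ)).sub (memLp_top_hatCdf hρ c)
    refine this.congr_norm ?_ ?_
    · exact ((continuous_hatCdf ρ).comp (continuous_const.sub continuous_id)).aestronglyMeasurable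
    · refine Eventually.of_forall fun x => ?_
      have := hatCdf_add_neg hρ (x - c)
      rw [neg_sub] at this
      simp only [Pi.sub_apply]
      congr 1
      linarith
  have h0 : ∫ x, alternating N A x * hatCdf ρ (c - x) = 0 := by
    have e := integral_conv_mul (integrable_hatKernel hρ) (Eventually.of_forall (hatKernel_neg ρ))
      hA.integrable_alternating hg
    simp only [hconv] at e
    rw [← e, ← integral_zero ℝ ℝ (μ := volume)]
    refine integral_congr_ae ?_
    filter_upwards [h] with x hx
    rw [hx, zero_mul]
  have hterm : ∀ l ∈ Finset.range (N + 1), Integrable (fun x =>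
      (-1 : ℝ) ^ l * (ind (A l) x * hatCdf ρ (c - x))) volume := fun l hl => by
    have hl : l ≤ N := by have := Finset.mem_range.1 hl; omega
    exact (integrable_mul_top (integrable_ind (hA l hl).1 (hA.volume_lt_top hl)) hm).const_mul _
  have h1 : (-1) ^ k * ∫ x, ind (A k) x * hatCdf ρ (c - x) = 0 := by
    rw [← h0]
    simp only [alternating, Finset.sum_mul, mul_assoc]
    rw [integral_finsetSum _ hterm, Finset.sum_eq_single_of_mem k (Finset.mem_range.2 (by omega)),
      integral_const_mul]
    intro l hl hlk
    have hl : l ≤ N := by have := Finset.mem_range.1 hl; omega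
    rw [← integral_zero ℝ ℝ (μ := volume)]
    rcases lt_or_gt_of_ne hlk with hlt | hlt
    · refine integral_congr_ae ?_
      have : ∀ᵐ x, x ∉ A l := measure_eq_zero_iff_ae_notMem.1 (ih l hlt hl)
      filter_upwards [this] with x hx
      rw [ind, indicator_of_notMem hx, zero_mul, mul_zero]
    · congr 1; ext x
      by_cases hx : x ∈ A l
      · have h2 := ((hA l hl).2 hx).1
        have h3 := hτ.le hω (show k + 1 ≤ l by omega) (by omega)
        rw [hatCdf_eq_zero hρ (by linarith), mul_zero, mul_zero]
      · rw [ind, indicator_of_notMem hx, zero_mul, mul_zero]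
  have h2 := (mul_eq_zero.1 h1).resolve_left (pow_ne_zero _ (by norm_num))
  have hn : ∀ x, 0 ≤ ind (A k) x * hatCdf ρ (c - x) := fun x =>
    mul_nonneg (ind_nonneg _ x) (hatCdf_nonneg hρ _)
  have h3 := (integral_eq_zero_iff_of_nonneg hn
    (integrable_mul_top (integrable_ind (hA k hk).1 (hA.volume_lt_top hk)) hm)).1 h2
  refine measure_eq_zero_iff_ae_notMem.2 ?_
  filter_upwards [h3] with x hx hxA
  have h4 := ((hA k hk).2 hxA).2
  simp only [ind, indicator_of_mem hxA, one_mul, Pi.zero_apply] at hx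
  exact (hatCdf_pos hρ (by linarith : -ρ < c - x)).ne' hx

end Values

/-! ### Bar codes as profiles -/

lemma generatingBarCodes.exists_profile {ω : ℝ} (hω : 0 < ω) {z : ℝ → ℝ}
    (hz : z ∈ generatingBarCodes ω) :
    ∃ (N : ℕ) (τ : ℕ → ℝ), Separated ω N τ ∧ z =ᵐ[volume] profile N τ ∧
      Icc 0 1 ⊆ Icc (τ 0) (τ (N + 1)) := by
  obtain ⟨⟨-, -, hout⟩, n, t, c, ⟨hc, ht0, htn, hval⟩, hgap⟩ := hz
  have hn : 1 ≤ n := by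
    by_contra! h
    have : n = 0 := by omega
    subst this
    rw [ht0] at htn
    exact zero_ne_one htn
  have htmono : ∀ k l, k ≤ l → l ≤ n → t k ≤ t l := by
    intro k l hkl
    induction l, hkl using Nat.le_induction with
    | base => exact fun _ => le_rfl
    | succ l _ ih => exact fun hl => (ih (by omega)).trans (hval l (by omega)).1.le
  have ht0' : ∀ k ≤ n, 0 ≤ t k := fun k hk => ht0 ▸ htmono 0 k (Nat.zero_le k) hk
  have htn' : ∀ k ≤ n, t k ≤ 1 := fun k hk => htn ▸ htmono k n hk le_rfl
  -- The jumps start at `t 0` if the code starts with a bar and at `t 1` otherwise; their number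
  -- is even because the code vanishes on both sides of `[0, 1]`.
  obtain ⟨s, hs1, hs⟩ : ∃ s : ℕ, s ≤ 1 ∧
      ∀ k, s ≤ k + 1 → (if Even k then c else 1 - c) = (1 - (-1) ^ (k + 1 - s)) / 2 := by
    rcases hc with rfl | rfl
    · refine ⟨1, le_rfl, fun k _ => ?_⟩
      rw [Nat.add_sub_cancel]
      rcases Nat.even_or_odd k with h | h
      · rw [if_pos h, h.neg_one_pow]; norm_num
      · rw [if_neg (Nat.not_even_iff_odd.2 h), h.neg_one_pow]; norm_num
    · refine ⟨0, zero_le_one, fun k _ => ?_⟩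
      rw [Nat.sub_zero, pow_succ]
      rcases Nat.even_or_odd k with h | h
      · rw [if_pos h, h.neg_one_pow]; norm_num
      · rw [if_neg (Nat.not_even_iff_odd.2 h), h.neg_one_pow]; norm_num
  obtain ⟨N, hNe, hN1, hN2⟩ : ∃ N : ℕ, Even N ∧ n ≤ N + s ∧ N + s ≤ n + 1 := by
    rcases Nat.even_or_odd (n - s) with h | h
    · exact ⟨n - s, h, by omega, by omega⟩
    · exact ⟨n - s + 1, h.add_one, by omega, by omega⟩
  let τ : ℕ → ℝ := fun k => if k = 0 then -ω else if k ≤ N then t (k - 1 + s) else 1 + ω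
  have hτj : ∀ j < N, τ (j + 1) = t (j + s) := fun j hj => by
    simp only [τ, if_neg (Nat.succ_ne_zero j), if_pos (show j + 1 ≤ N by omega), Nat.add_sub_cancel]
  have hτ0 : τ 0 = -ω := by simp [τ]
  have hτN : τ (N + 1) = 1 + ω := by simp [τ]
  refine ⟨N, τ, ?_, ?_, ?_⟩
  · intro k hk
    rcases Nat.eq_zero_or_pos k with rfl | hk0
    · rw [hτ0]
      rcases Nat.eq_zero_or_pos N with hN0 | hN0
      · have : τ (0 + 1) = 1 + ω := by rw [← hτN, hN0]
        rw [this]; linarith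
      · rw [hτj 0 hN0]
        linarith [ht0' (0 + s) (by omega)]
    · obtain ⟨k, rfl⟩ : ∃ j, k = j + 1 := ⟨k - 1, by omega⟩
      rw [hτj k (by omega)]
      rcases Nat.lt_or_ge (k + 1) N with hkN | hkN
      · rw [hτj (k + 1) hkN]
        have := hgap (k + s) (by omega)
        rw [show k + 1 + s = k + s + 1 by omega]
        linarith
      · have : τ (k + 1 + 1) = 1 + ω := by rw [← hτN]; congr 1; omega
        rw [this]
        linarith [htn' (k + s) (by omega)]
  · have hall : ∀ᵐ x, ∀ k, k < n → x ∈ Ioo (t k) (t (k + 1)) →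
        z x = if Even k then c else 1 - c := by
      rw [ae_all_iff]
      intro k
      by_cases hk : k < n
      · filter_upwards [(hval k hk).2] with x hx _ using hx
      · exact Eventually.of_forall fun x h => absurd h hk
    have hne : ∀ᵐ x, ∀ k, x ≠ t k := ae_all_iff.2 fun k => Measure.ae_ne volume (t k)
    filter_upwards [hall, hne, hout] with x h1 h2 h3
    rcases lt_or_ge x 0 with hx0 | hx0
    · rw [h3 fun h => absurd h.1 (not_le.2 hx0), profile_apply_of_lt (Nat.zero_le N)
        (fun j hj => absurd hj (Nat.not_lt_zero j)) (fun j _ hj => ?_)]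
      · norm_num
      · rw [hτj j hj]; linarith [ht0' (j + s) (by omega)]
    rcases lt_or_ge 1 x with hx1 | hx1
    · rw [h3 fun h => absurd h.2 (not_le.2 hx1), profile_apply_of_lt le_rfl (fun j hj => ?_)
        (fun j h hj => absurd hj (not_lt.2 h)), hNe.neg_one_pow]
      · norm_num
      · rw [hτj j hj]; linarith [htn' (j + s) (by omega)]
    have hx0' : t 0 < x := lt_of_le_of_ne (by rw [ht0]; exact hx0) (h2 0).symm
    have hx1' : x < t n := lt_of_le_of_ne (by rw [htn]; exact hx1) (h2 n)
    obtain ⟨k, hk, hxk⟩ := exists_mem_Ioo_of_lt h2 hx0' hx1'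
    rw [h1 k hk hxk, hs k (by omega), profile_apply_of_lt (m := k + 1 - s) (by omega)]
    · intro j hj
      rw [hτj j (by omega)]
      exact (htmono (j + s) k (by omega) hk.le).trans_lt hxk.1
    · intro j hj hjN
      rw [hτj j hjN]
      exact hxk.2.le.trans (htmono (k + 1) (j + s) (by omega) (by omega))
  · rw [hτ0, hτN]
    exact Icc_subset_Icc (by linarith) (by linarith)

lemma measurable_profile (N : ℕ) (τ : ℕ → ℝ) : Measurable (profile N τ) :=
  Finset.measurable_fun_sum _ fun _ _ =>
    (measurable_const.indicator measurableSet_Ioi).const_mul _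

/-- Every bar code is the sum of a given profile and a perturbation of alternating sign. The
intervals on which it disagrees with the profile almost everywhere are collected in `M`; on these
the perturbation is made to fill the interval exactly. -/
lemma barCodes.exists_alternating {ω : ℝ} (hω : 0 < ω) {N : ℕ} {τ : ℕ → ℝ}
    (hτ : Separated ω N τ) (hwin : Icc 0 1 ⊆ Icc (τ 0) (τ (N + 1))) {u z : ℝ → ℝ}
    (hz : z ∈ barCodes) (hzp : z =ᵐ[volume] profile N τ) (hu : u ∈ barCodes) :
    ∃ (A : ℕ → Set ℝ) (M : Finset ℕ), Fits N τ A ∧ M ⊆ Finset.range (N + 1) ∧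
      (∀ k ∈ M, A k = Ioo (τ k) (τ (k + 1))) ∧
      (∀ k ≤ N, k ∉ M → volume (Ioo (τ k) (τ (k + 1)) \ A k) ≠ 0) ∧
      u =ᵐ[volume] fun x => profile N τ x + alternating N A x := by
  classical
  obtain ⟨v, hvm, huv⟩ := hu.1.1.aestronglyMeasurable
  let B : ℕ → Set ℝ := fun k => Ioo (τ k) (τ (k + 1)) ∩ {x | v x ≠ profile N τ x}
  have hB : ∀ k, MeasurableSet (B k) := fun k =>
    measurableSet_Ioo.inter
      (measurableSet_eq_fun hvm.measurable (measurable_profile N τ)).compl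
  let M : Finset ℕ := (Finset.range (N + 1)).filter
    fun k => volume (Ioo (τ k) (τ (k + 1)) \ B k) = 0
  let A : ℕ → Set ℝ := fun k => if k ∈ M then Ioo (τ k) (τ (k + 1)) else B k
  have hAB : ∀ k, ∀ᵐ x, (x ∈ A k ↔ x ∈ B k) := by
    intro k
    by_cases hk : k ∈ M
    · have h1 : volume (Ioo (τ k) (τ (k + 1)) \ B k) = 0 := (Finset.mem_filter.1 hk).2
      filter_upwards [measure_eq_zero_iff_ae_notMem.1 h1] with x hx
      simp only [A, if_pos hk]
      exact ⟨fun h => by_contra fun h' => hx ⟨h, h'⟩, fun h => h.1⟩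
    · simp [A, hk]
  have hA : Fits N τ A := by
    intro k _
    by_cases hk : k ∈ M
    · simp only [A, if_pos hk]
      exact ⟨measurableSet_Ioo, Subset.rfl⟩
    · simp only [A, if_neg hk]
      exact ⟨hB k, inter_subset_left⟩
  refine ⟨A, M, hA, Finset.filter_subset _ _, fun k hk => if_pos hk, fun k hk hkM => ?_, ?_⟩
  · simp only [A, if_neg hkM]
    exact fun h => hkM (Finset.mem_filter.2 ⟨Finset.mem_range.2 (by omega), h⟩)
  · have hne : ∀ᵐ x, ∀ k, x ≠ τ k := ae_all_iff.2 fun k => Measure.ae_ne volume (τ k)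
    filter_upwards [huv, hu.2.1, hu.2.2, hz.2.2, hzp, hne, ae_all_iff.2 hAB]
      with x h1 h2 h3 h4 h5 h6 h7
    by_cases hx : τ 0 < x ∧ x < τ (N + 1)
    · obtain ⟨k, hk, hxk⟩ := exists_mem_Ioo_of_lt h6 hx.1 hx.2
      have hk : k ≤ N := by omega
      rw [hA.alternating_apply hτ hω.le hk hxk]
      have hp := hτ.profile_apply hω.le hk hxk
      by_cases hxA : x ∈ A k
      · have hxB : v x ≠ profile N τ x := ((h7 k).1 hxA).2
        rw [ind, indicator_of_mem hxA, hp, mul_one]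
        rw [← h1, hp] at hxB
        rcases neg_one_pow_eq_or ℝ k with hs | hs
        · rw [hs] at hxB ⊢
          norm_num at hxB ⊢
          exact h2.resolve_left hxB
        · rw [hs] at hxB ⊢
          norm_num at hxB ⊢
          exact h2.resolve_right hxB
      · have hxB : v x = profile N τ x := by
          by_contra h
          exact hxA ((h7 k).2 ⟨hxk, h⟩)
        rw [ind, indicator_of_notMem hxA, mul_zero, add_zero, h1, hxB]
    · have hx01 : x ∉ Icc (0 : ℝ) 1 := by
        intro h
        have := hwin h
        exact hx ⟨lt_of_le_of_ne this.1 (h6 0).symm, lt_of_le_of_ne this.2 (h6 (N + 1))⟩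
      rw [h3 hx01, ← h5, h4 hx01, zero_add, alternating, Finset.sum_eq_zero]
      intro k hk
      have hk : k ≤ N := by have := Finset.mem_range.1 hk; omega
      rw [ind, indicator_of_notMem, mul_zero]
      intro h
      have h8 := (hA k hk).2 h
      have h9 := hτ.le hω.le (Nat.zero_le k) (by omega)
      have h10 := hτ.le hω.le (show k + 1 ≤ N + 1 by omega) le_rfl
      exact hx ⟨h9.trans_lt h8.1, h8.2.trans_le h10⟩

/-! ### Minimality of the generating bar code -/

/-- Comparison of a bar code `u` with the generating bar code `z`: the energy of `u` is at least
that of `z`, with equality only for `u = z`. -/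
lemma deblurFunctional_comparison {lam σ ρ ω : ℝ} {z u : ℝ → ℝ} (hl : 0 < lam) (hσ : 0 < σ)
    (hz : z ∈ generatingBarCodes ω) (h : σ ≤ ρ) (hω : ρ ≤ ω / 2)
    (hlam : 2 / lam + 1 / (15 * ρ ^ 2) * (-σ ^ 3 + 5 * ρ * σ ^ 2 + 17 * ρ ^ 3) < ω)
    (hu : u ∈ barCodes) :
    deblurFunctional lam (hatKernel ρ) (conv (hatKernel σ) z) z ≤
        deblurFunctional lam (hatKernel ρ) (conv (hatKernel σ) z) u ∧
      (deblurFunctional lam (hatKernel ρ) (conv (hatKernel σ) z) u ≤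
        deblurFunctional lam (hatKernel ρ) (conv (hatKernel σ) z) z → u =ᵐ[volume] z) := by
  have hρ := hσ.trans_le h
  have hω0 : 0 < ω := by linarith
  obtain ⟨N, τ, hτ, hzp, hwin⟩ := generatingBarCodes.exists_profile hω0 hz
  obtain ⟨A, M, hA, hM, hfull, hmiss, hue⟩ :=
    barCodes.exists_alternating hω0 hτ hwin hz.1 hzp hu
  have hiρ := integrable_hatKernel hρ
  have hiσ := integrable_hatKernel hσ
  have hzi : Integrable z volume := hz.1.1.1
  have hzt := BV.memLp_top hz.1.1
  have hfi := integrable_conv hiσ hzi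
  have hft := memLp_top_conv hiσ hzi hzt
  have hbi := integrable_conv hiρ hA.integrable_alternating
  have hbt := memLp_top_conv hiρ hA.integrable_alternating hA.memLp_top_alternating
  set f := conv (hatKernel σ) z with hf
  set a : ℝ → ℝ := fun x => conv (hatKernel ρ) z x - f x with ha
  set b : ℝ → ℝ := conv (hatKernel ρ) (alternating N A) with hb
  have hai : Integrable a volume := (integrable_conv hiρ hzi).sub hfi
  have hat : MemLp a ∞ volume := (memLp_top_conv hiρ hzi hzt).sub hft
  have hconvz : ∀ x, a x = conv (hatKernel ρ) (profile N τ) x - conv (hatKernel σ) (profile N τ) x :=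
    fun x => by rw [ha, hf, conv_congr_right _ hzp, conv_congr_right _ hzp]
  have hconvu : ∀ x, conv (hatKernel ρ) u x - f x = b x - -a x := by
    intro x
    rw [conv_congr_right _ hue, conv_add hiρ (memLp_top_profile N τ) hA.memLp_top_alternating,
      ← conv_congr_right _ hzp]
    simp only [ha, hb]; ring
  have hFz := deblurFunctional_eq hl.le hiρ hfi hft hzi hzt
  have hFu := deblurFunctional_eq hl.le hiρ hfi hft hu.1.1 (BV.memLp_top hu.1)
  have hsq : ∫ x, (conv (hatKernel ρ) u x - f x) ^ 2 =
      (∫ x, b x * b x) + 2 * (∫ x, b x * a x) + ∫ x, a x ^ 2 := by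
    simp only [hconvu]
    have := integral_sub_sq hbi hbt hai.neg hat.neg
    simp only [Pi.neg_apply, mul_neg, neg_mul, neg_neg, integral_neg] at this
    rw [this]
    simp only [sq]; ring
  have henergy := hA.energy_lower_bound hσ h (by linarith : 2 * ρ ≤ ω) hτ M hM hfull
  simp only [← hconvz] at henergy
  have hconst : 2 * halfMeanAbs ρ ρ + 4 * halfMeanAbs ρ σ =
      1 / (15 * ρ ^ 2) * (-σ ^ 3 + 5 * ρ * σ ^ 2 + 17 * ρ ^ 3) := by
    unfold halfMeanAbs
    field_simp
    ring
  set κ := ω - 2 * halfMeanAbs ρ ρ - 4 * halfMeanAbs ρ σ with hκ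
  have hκ2 : 2 < lam * κ := by
    have : 2 / lam < κ := by rw [hκ]; linarith
    rwa [div_lt_iff₀ hl, mul_comm] at this
  set R := ∫ x, conv (hatKernel ρ) (alternating N fun k => if k ∈ M then ∅ else A k) x *
        conv (hatKernel ρ) (alternating N fun k => if k ∈ M then ∅ else A k) x with hR
  have hR0 : 0 ≤ R := integral_nonneg fun x => mul_self_nonneg _
  have hTz : totalVariation z ≤ N :=
    (totalVariation_congr hzp).trans_le (totalVariation_profile_le N τ)
  have hTu := hA.le_totalVariation_add hω0 hτ M hM hmiss hu.1.1 hue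
  set V := (totalVariation u).toReal with hV
  have hVe : totalVariation u = ENNReal.ofReal V := (ENNReal.ofReal_toReal hu.1.2.ne).symm
  have hV0 : 0 ≤ V := ENNReal.toReal_nonneg
  have hTu' : (N : ℝ) ≤ V + 2 * M.card := by
    have h1 : totalVariation u + 2 * (M.card : ℝ≥0∞) ≠ ∞ :=
      ENNReal.add_ne_top.2 ⟨hu.1.2.ne, ENNReal.mul_ne_top (by simp) (ENNReal.natCast_ne_top _)⟩
    have h2 := ENNReal.toReal_mono h1 hTu
    rw [ENNReal.toReal_add hu.1.2.ne (ENNReal.mul_ne_top (by simp) (ENNReal.natCast_ne_top _))] at h2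
    simpa using h2
  have hFz' : deblurFunctional lam (hatKernel ρ) f z ≤
      ENNReal.ofReal (N + lam * ∫ x, a x ^ 2) := by
    rw [hFz, ENNReal.ofReal_add (Nat.cast_nonneg N)
      (mul_nonneg hl.le (integral_nonneg fun x => sq_nonneg _)), ENNReal.ofReal_natCast]
    gcongr
  have hFu' : deblurFunctional lam (hatKernel ρ) f u = ENNReal.ofReal
      (V + lam * ((∫ x, b x * b x) + 2 * (∫ x, b x * a x) + ∫ x, a x ^ 2)) := by
    rw [hFu, ENNReal.ofReal_add hV0
      (mul_nonneg hl.le (hsq ▸ integral_nonneg fun x => sq_nonneg _)), hVe, hsq]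
  have hcard : (0 : ℝ) ≤ M.card := Nat.cast_nonneg _
  have hkey : N + lam * (∫ x, a x ^ 2) + (M.card * (lam * κ - 2) + lam * R) ≤
      V + lam * ((∫ x, b x * b x) + 2 * (∫ x, b x * a x) + ∫ x, a x ^ 2) := by
    have := mul_le_mul_of_nonneg_left henergy hl.le
    linarith
  have hgap : 0 ≤ (M.card : ℝ) * (lam * κ - 2) := mul_nonneg hcard (by linarith)
  have hgap' : 0 ≤ lam * R := mul_nonneg hl.le hR0
  refine ⟨?_, fun hle => ?_⟩
  · refine hFz'.trans ?_
    rw [hFu']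
    exact ENNReal.ofReal_le_ofReal (by linarith)
  · have h1 := hle.trans hFz'
    rw [hFu', ENNReal.ofReal_le_ofReal_iff (add_nonneg (Nat.cast_nonneg N)
      (mul_nonneg hl.le (integral_nonneg fun x => sq_nonneg _)))] at h1
    -- Equality forces both nonnegative gaps to vanish.
    have hM0 : M = ∅ := by
      have h2 : (M.card : ℝ) * (lam * κ - 2) = 0 := by linarith
      have h3 := (mul_eq_zero.1 h2).resolve_right (by linarith)
      exact Finset.card_eq_zero.1 (by exact_mod_cast h3)
    have hR1 : R = 0 := (mul_eq_zero.1 (show lam * R = 0 by linarith)).resolve_left hl.ne'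
    rw [hR, hM0] at hR1
    simp only [Finset.notMem_empty, if_false] at hR1
    have hb0 : ∀ᵐ x, b x = 0 := by
      have := (integral_eq_zero_iff_of_nonneg (fun x => mul_self_nonneg (b x))
        (integrable_mul_top hbi hbt)).1 hR1
      filter_upwards [this] with x hx
      exact mul_self_eq_zero.1 hx
    have hnull := hA.volume_eq_zero_of_conv hρ hω0.le hτ hb0
    have hall : ∀ᵐ x, ∀ k, k ≤ N → x ∉ A k := by
      rw [ae_all_iff]
      intro k
      by_cases hk : k ≤ N
      · filter_upwards [measure_eq_zero_iff_ae_notMem.1 (hnull k hk)] with x hx _ using hx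
      · exact Eventually.of_forall fun x h => absurd h hk
    filter_upwards [hue, hzp, hall] with x h2 h3 h4
    rw [h2, h3, alternating, Finset.sum_eq_zero, add_zero]
    intro k hk
    rw [ind, indicator_of_notMem (h4 k (by have := Finset.mem_range.1 hk; omega)), mul_zero]

end BarCode

theorem theorem2 :
    (∀ (lam σ ρ : ℝ) (φσ φρ z : ℝ → ℝ), 0 < lam →
      φσ ∈ BarCode.kernelClass σ → φρ ∈ BarCode.kernelClass ρ → z ∈ BarCode.barCodes →
      (BarCode.IsUniqueMinimiser
          (BarCode.deblurFunctional lam φρ (BarCode.conv φσ z)) BarCode.BV (fun _ => 0) ↔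
        BarCode.starNorm (BarCode.conv φρ (BarCode.conv φσ z))
          ≤ ENNReal.ofReal (1 / (2 * lam)))) ∧
    (∀ (lam σ ρ ω : ℝ) (i j : Fin 2) (z : ℝ → ℝ), 0 < lam → 0 < σ →
      z ∈ BarCode.generatingBarCodes ω → z ∈ BarCode.barCodesEnds i j →
      σ ≤ ρ → ρ ≤ ω / 2 →
      2 / lam + 1 / (15 * ρ ^ 2) * (-σ ^ 3 + 5 * ρ * σ ^ 2 + 17 * ρ ^ 3) < ω →
      BarCode.IsUniqueMinimiser
        (BarCode.deblurFunctional lam (BarCode.hatKernel ρ)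
          (BarCode.conv (BarCode.hatKernel σ) z))
        (BarCode.barCodesEnds i j) z) := by
  refine ⟨fun lam σ ρ φσ φρ z hl hσ hρ hz => ?_, ?_⟩
  · exact BarCode.isUniqueMinimiser_zero_iff hl hρ.2.1 (BarCode.kernelClass.even hρ)
      (BarCode.integrable_conv hσ.2.1 hz.1.1)
      (BarCode.memLp_top_conv hσ.2.1 hz.1.1 (BarCode.BV.memLp_top hz.1))
  intro lam σ ρ ω i j z hl hσ hz hze h hω hlam
  have key := fun u (hu : u ∈ BarCode.barCodes) =>
    BarCode.deblurFunctional_comparison hl hσ hz h hω hlam hu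
  refine ⟨hze, isMinOn_iff.2 fun u hu => (key u hu.1).1, fun v hv hmin => ?_⟩
  exact (key v hv.1).2 (isMinOn_iff.1 hmin z hze)
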